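/- Let $\mathbb T^1=\mathbb R/\mathbb Z$ and $\mathbb T^2=\mathbb R^2/\mathbb Z^2$ with normalized Lebesgue measure and the flat metrics $d$. Fix $M_0\in\mathbb N$, $K_0,K_1>0$ and $\alpha\in(0,1]$. Then there is a constant $L_0=L_0(K_0,K_1,M_0,\alpha)>0$ such that the following holds. Let $(L_n)_{n\ge1}$ be a nondecreasing real sequence with $L_1\ge L_0$ and $\lim_{N\to\infty}N^8L_N^{-\alpha/(3\alpha+4)}=0$. For each $n\ge1$ let $f_n$ be a $C^3$ function on $\mathbb T^1$ with real values, well defined modulo $1$ (that is, given by a $C^3$ function $f_n:\mathbb R\to\mathbb R$ such that $f_n(x+1)-f_n(x)$ is a constant integer; the integer is $0$ when $f_n$ is a function $\mathbb T^1\to\mathbb R$), such that (H1) $\|f_n'\|_{C^0}+\|f_n''\|_{C^0}\le K_0L_n$; (H2) $\mathcal C_n=\{\hat x\in\mathbb T^1: f_n'(\hat x)=0\}$ is nonempty and finite, with at most $M_0$ elements; (H3) $|f_n'(x)|\ge L_nK_1^{-1}\,d(x,\mathcal C_n)$ for all $x\in\mathbb T^1$. Put $F_n(x,y)=(f_n(x)-y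 \ (\mathrm{mod}\ 1),\,x)$ on $\mathbb T^2$, $F^0=\mathrm{Id}$ and $F^n=F_n\circ\cdots\circ F_1$. Let $\phi:\mathbb T^2\to\mathbb R$ be $\alpha$-Hölder continuous with $\int\phi=0$. Then $$\int\phi(x,y)^2\,dx\,dy+2\int\phi(x,z)\phi(z,y)\,dx\,dy\,dz=\sigma^2\qquad\text{for some }\sigma\ge0.$$ If $\sigma>0$ and $X$ is a uniformly distributed $\mathbb T^2$-valued random variable, then $$\frac1{\sigma\sqrt N}\sum_{i=0}^N\phi\circ F^i(X)$$ converges in distribution to a standard Gaussian as $N\to\infty$. Moreover, $\sigma=0$ if and only if there is a continuous $\psi:\mathbb T^1\to\mathbb R$ with $\phi(x,y)=\psi(x)-\psi(y)$ for all $x,y\in\mathbb T^1$. -/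

import Mathlib

open MeasureTheory ProbabilityTheory Filter Topology
open scoped NNReal

namespace StdMap

/-- The two-torus `ℝ² / ℤ²`; `volume` on it is the normalized Lebesgue measure. -/
abbrev Torus2 : Type := UnitAddCircle × UnitAddCircle

/-- The critical set `{x̂ ∈ 𝕋¹ : f'(x̂) = 0}` of a circle map given by its lift `f : ℝ → ℝ`. -/
def critSet (f : ℝ → ℝ) : Set UnitAddCircle :=
  {c | ∃ x : ℝ, (x : UnitAddCircle) = c ∧ deriv f x = 0}

/-- `f` is a `C³` function on the circle, well defined modulo `1` (the case `d = 0` is that of a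
real-valued function on the circle), which satisfies the hypotheses (H1), (H2), (H3) with
parameters `M₀`, `K₀`, `K₁` and coefficient `L`. -/
structure Admissible (M₀ : ℕ) (K₀ K₁ L : ℝ) (f : ℝ → ℝ) : Prop where
  contDiff : ContDiff ℝ 3 f
  degree : ∃ d : ℤ, ∀ x : ℝ, f (x + 1) = f x + d
  /-- `‖f'‖ + ‖f''‖ ≤ K₀ L` in the supremum norms. -/
  norm_le : ∀ x y : ℝ, |deriv f x| + |deriv (deriv f) y| ≤ K₀ * L
  crit_finite : (critSet f).Finite
  crit_card : (critSet f).ncard ≤ M₀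
  /-- Automatic if `d = 0`; otherwise it is part of the next condition under the usual convention
  that the distance to the empty set is infinite (`Metric.infDist` would be `0`). -/
  crit_nonempty : (critSet f).Nonempty
  le_abs_deriv : ∀ x : ℝ, L * K₁⁻¹ * Metric.infDist (x : UnitAddCircle) (critSet f) ≤ |deriv f x|

/-- The map `(x, y) ↦ (f(x) - y (mod 1), x)` of the torus, where the circle is parametrized by
`[0, 1)`. -/
noncomputable def torusMap (f : ℝ → ℝ) (p : Torus2) : Torus2 :=
  (((f (AddCircle.equivIco (1 : ℝ) 0 p.1 : ℝ) : ℝ) : UnitAddCircle) - p.2, p.1)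

/-- The composition `Fⁿ = F_n ∘ F_{n-1} ∘ ⋯ ∘ F_1`, with `F⁰ = id`. -/
noncomputable def comp (f : ℕ → ℝ → ℝ) : ℕ → Torus2 → Torus2
  | 0 => id
  | n + 1 => torusMap (f (n + 1)) ∘ comp f n

/-- `∫ φ(x,y)² dx dy + 2 ∫ φ(x,z) φ(z,y) dx dy dz`. -/
noncomputable def asympVar (φ : Torus2 → ℝ) : ℝ :=
  (∫ p : Torus2, φ p ^ 2) +
    2 * ∫ q : UnitAddCircle × UnitAddCircle × UnitAddCircle, φ (q.1, q.2.2) * φ (q.2.2, q.2.1)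

end StdMap

/-!
The growth hypothesis on `L` makes the orbit behave, for the purpose of the central limit theorem,
like a sequence of independent uniform points, and it does so whatever `L 1` is, so that `L₀ = 1`
works.

*Martingale-coboundary decomposition.* With `ψ y = ∫ φ (x, y) dx`, the observable
`m (x, y) = φ (x, y) - ψ y + ψ x` satisfies `∫ m (x, y) dx = 0` for all `y`, and
`∫ m ^ 2 = asympVar φ` (`integral_martingalePart_sq`). This gives `σ`, and `σ = 0` forces `m = 0`,
that is `φ (x, y) = ψ y - ψ x`. The second coordinate of `F (p)` is the first one of `p`, so the
Birkhoff sums of `φ` and `m` differ by a telescoping, hence bounded, term.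

*Decorrelation.* On the horizontal circle at height `y` the orbit lifts to functions `X i` of one
real parameter with `X (i + 2) = g i (X (i + 1)) - X i`, `g i` being the successive maps. So the
derivative `u i` of `X i` solves a second-order recursion, which expands strongly as long as the
orbit keeps away from the critical sets. Cutoffs at scale `η` around these sets ensure this; the
bound on the number of critical points and the linear growth of the derivative away from them make
the measure of the region cut off of order `η`. Let `A` be the product of cut-off observables up to
time `n`, let `h` be an observable whose mean over the first variable vanishes, and `H` its periodic
primitive in that variable. Then `A * h (X (n + 1), X n)` is the derivative of the periodic function
`A * H (X (n + 1), X n) / u (n + 1)` up to an error of order `1 / (Λ * η ^ 2)`, where `Λ` bounds the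
coefficients from below; hence its integral is of this order (`norm_integral_weight_mul_le`). No
distribution of the orbit has to be propagated: the expansion and the bounded distortion
(`distortion_of_recursion`) of the recursion suffice.

*Characteristic functions.* For `e = exp (i θ m)`, with `m` mollified at scale `η`, decorrelation is
used twice: to replace the last factor of the product along the orbit by its mean over the first
variable, which is `1 + O (θ ^ 2)` because `m` is centered, and to replace this mean by its
integral. So one step multiplies the integral of the product by `∫ e` up to an error of order
`|θ| ^ 3 + η ^ α + 1 / (Λ * η ^ 2)` (`Decorrelating.norm_integral_succ_sub_le`), and the
characteristic function of the sum of `n` terms is the `n`-th power of that of `m` up to `n` such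
errors (`exists_norm_charFun_sub_pow_le`).

*Conclusion.* The first `N ^ (1 / 4)` terms contribute `O (N ^ (-1 / 4))` after normalization and
are dropped; from then on the growth hypothesis bounds the coefficients below by
`N ^ (2 + 4 / α)`. With `η = N ^ (-2 / α)` and `θ` of order `N ^ (-1 / 2)`, the total error is
`O (N ^ (-1 / 4))`. The powers converge to the Gaussian characteristic function as in the case of
independent variables, and Lévy's continuity theorem concludes.
-/

namespace StdMap

/-! ### Cocycles of second-order recursions -/

/-- A second-order recursion with coefficients of size at least `2 * r` expands by `r` at each
step. -/
lemma expansion_of_recursion {u c : ℕ → ℝ} {r : ℝ} {n : ℕ} (hr : 2 ≤ r) (h0 : u 0 = 0)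
    (h1 : u 1 = 1) (hu : ∀ i, u (i + 2) = c i * u (i + 1) - u i)
    (hc : ∀ i < n, 2 * r ≤ |c i|) {i : ℕ} (hi : i ≤ n) :
    r * |u i| ≤ |u (i + 1)| ∧ 0 < |u (i + 1)| := by
  induction i with
  | zero => simp [h0, h1]
  | succ i ih =>
    obtain ⟨h2, h3⟩ := ih (by omega)
    have hci := hc i (by omega)
    have h4 : |c i| * |u (i + 1)| - |u i| ≤ |u (i + 1 + 1)| := by
      rw [hu i, ← abs_mul]; exact abs_sub_abs_le_abs_sub _ _
    have h5 : 2 * r * |u (i + 1)| ≤ |c i| * |u (i + 1)| :=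
      mul_le_mul_of_nonneg_right hci h3.le
    have h6 : |u i| ≤ r * |u (i + 1)| := by nlinarith [abs_nonneg (u i)]
    refine ⟨by linarith, ?_⟩
    have : 0 < r * |u (i + 1)| := by positivity
    linarith

lemma half_coeff_le_of_recursion {u c : ℕ → ℝ} {r : ℝ} {n : ℕ} (hr : 2 ≤ r) (h0 : u 0 = 0)
    (h1 : u 1 = 1) (hu : ∀ i, u (i + 2) = c i * u (i + 1) - u i)
    (hc : ∀ i < n, 2 * r ≤ |c i|) {i : ℕ} (hi : i < n) :
    |c i| / 2 * |u (i + 1)| ≤ |u (i + 2)| := by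
  obtain ⟨h2, h3⟩ := expansion_of_recursion hr h0 h1 hu hc hi.le
  have hci := hc i hi
  have h4 : |c i| * |u (i + 1)| - |u i| ≤ |u (i + 2)| := by
    rw [hu i, ← abs_mul]; exact abs_sub_abs_le_abs_sub _ _
  have h5 : 2 * r * |u (i + 1)| ≤ |c i| * |u (i + 1)| := mul_le_mul_of_nonneg_right hci h3.le
  have h6 : |u i| ≤ r * |u (i + 1)| := by nlinarith [abs_nonneg (u i)]
  linarith

/-- The solution dominates the sum of its earlier values, up to the factor `2 / r`. -/
lemma sum_abs_le_of_recursion {u c : ℕ → ℝ} {r : ℝ} {n : ℕ} (hr : 2 ≤ r) (h0 : u 0 = 0)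
    (h1 : u 1 = 1) (hu : ∀ i, u (i + 2) = c i * u (i + 1) - u i)
    (hc : ∀ i < n, 2 * r ≤ |c i|) {i : ℕ} (hi : i ≤ n) :
    ∑ j ∈ Finset.range (i + 1), |u j| ≤ 2 / r * |u (i + 1)| := by
  have hr0 : 0 < r := by linarith
  induction i with
  | zero => simp [h0, h1]; positivity
  | succ i ih =>
    rw [Finset.sum_range_succ]
    have h2 := ih (by omega)
    have h3 := (expansion_of_recursion hr h0 h1 hu hc hi).1
    have h4 : 2 / r * |u (i + 1)| ≤ 1 * |u (i + 1)| :=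
      mul_le_mul_of_nonneg_right (by rw [div_le_one hr0]; exact hr) (abs_nonneg _)
    calc _ ≤ 2 * |u (i + 1)| := by linarith
      _ = 2 / r * (r * |u (i + 1)|) := by field_simp
      _ ≤ _ := by gcongr

/-- Bounded distortion: along an expanding second-order recursion, the solution of the linearized
recursion is controlled by the square of the solution. -/
lemma distortion_of_recursion {u w c d Q : ℕ → ℝ} {r κ : ℝ} {n : ℕ} (hr : 2 ≤ r) (h0 : u 0 = 0)
    (h1 : u 1 = 1) (hu : ∀ i, u (i + 2) = c i * u (i + 1) - u i)
    (hc : ∀ i < n, 2 * r ≤ |c i|) (hw0 : w 0 = 0) (hw1 : w 1 = 0)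
    (hw : ∀ i, w (i + 2) = d i * u (i + 1) ^ 2 + c i * w (i + 1) - w i) (hκ0 : 0 ≤ κ)
    (hκ : κ ≤ 1 / 4) (hcQ : ∀ i < n, |c i| ≤ Q i) (hdQ : ∀ i < n, |d i| ≤ Q i)
    (hQ : ∀ i < n, 4 * Q i ≤ κ * |c i| ^ 2) {i : ℕ} (hi : i ≤ n) :
    |w i| ≤ 2 * κ * u i ^ 2 ∧ |w (i + 1)| ≤ 2 * κ * u (i + 1) ^ 2 := by
  induction i with
  | zero => simp [h0, h1, hw0, hw1]; exact hκ0
  | succ i ih =>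
    obtain ⟨h2, h3⟩ := ih (by omega)
    refine ⟨h3, ?_⟩
    have hi' : i < n := by omega
    have hexp := expansion_of_recursion hr h0 h1 hu hc hi
    have hexp0 := (expansion_of_recursion hr h0 h1 hu hc hi'.le).1
    have hhalf := half_coeff_le_of_recursion hr h0 h1 hu hc hi'
    have e1 : (|c i| / 2) ^ 2 * u (i + 1) ^ 2 ≤ u (i + 2) ^ 2 := by
      rw [← sq_abs (u (i + 1)), ← sq_abs (u (i + 2)), ← mul_pow]
      exact pow_le_pow_left₀ (by positivity) hhalf 2
    have e2 : 4 * u i ^ 2 ≤ u (i + 1) ^ 2 := by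
      rw [← sq_abs (u (i + 1)), ← sq_abs (u i)]
      have : 2 * |u i| ≤ |u (i + 1)| :=
        (mul_le_mul_of_nonneg_right hr (abs_nonneg _)).trans hexp0
      nlinarith [abs_nonneg (u i)]
    have e3 : 4 * u (i + 1) ^ 2 ≤ u (i + 2) ^ 2 := by
      rw [← sq_abs (u (i + 1)), ← sq_abs (u (i + 2))]
      have : 2 * |u (i + 1)| ≤ |u (i + 2)| :=
        (mul_le_mul_of_nonneg_right hr (abs_nonneg _)).trans hexp.1
      nlinarith [abs_nonneg (u (i + 1))]
    have e4 : Q i * u (i + 1) ^ 2 ≤ κ * u (i + 2) ^ 2 := by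
      have := mul_le_mul_of_nonneg_right (hQ i hi') (sq_nonneg (u (i + 1)))
      nlinarith
    have e5 : |w (i + 2)| ≤ |d i| * u (i + 1) ^ 2 + |c i| * |w (i + 1)| + |w i| := by
      rw [hw i]
      refine (abs_sub _ _).trans (add_le_add ((abs_add_le _ _).trans_eq ?_) le_rfl)
      rw [abs_mul, abs_mul, abs_of_nonneg (sq_nonneg (u (i + 1)))]
    have hQ0 : 0 ≤ Q i := (abs_nonneg _).trans (hdQ i hi')
    have e6 : |d i| * u (i + 1) ^ 2 ≤ Q i * u (i + 1) ^ 2 :=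
      mul_le_mul_of_nonneg_right (hdQ i hi') (sq_nonneg _)
    have e7 : |c i| * |w (i + 1)| ≤ 2 * κ * (Q i * u (i + 1) ^ 2) := by
      calc _ ≤ Q i * (2 * κ * u (i + 1) ^ 2) :=
            mul_le_mul (hcQ i hi') h3 (abs_nonneg _) hQ0
        _ = _ := by ring
    have e8 : 2 * κ * (Q i * u (i + 1) ^ 2) ≤ 2 * κ * (κ * u (i + 2) ^ 2) := by gcongr
    have e9 : 16 * (κ * u i ^ 2) ≤ κ * u (i + 2) ^ 2 := by nlinarith
    have e10 : κ * (κ * u (i + 2) ^ 2) ≤ 1 / 4 * (κ * u (i + 2) ^ 2) := by gcongr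
    change |w (i + 2)| ≤ 2 * κ * u (i + 2) ^ 2
    have : 0 ≤ κ * u (i + 2) ^ 2 := by positivity
    linarith

/-! ### Orbits on horizontal lines -/

/-- The lift to the line of the orbit of the horizontal circle at height `y`, parametrized by the
horizontal coordinate: consecutive terms, starting with the height `y` and the parameter. -/
def orbit (g : ℕ → ℝ → ℝ) (y : ℝ) : ℕ → ℝ → ℝ
  | 0 => fun _ => y
  | 1 => fun s => s
  | n + 2 => fun s => g n (orbit g y (n + 1) s) - orbit g y n s

/-- The derivative of `orbit` in the parameter. -/
noncomputable def orbitDeriv (g : ℕ → ℝ → ℝ) (y : ℝ) : ℕ → ℝ → ℝ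
  | 0 => fun _ => 0
  | 1 => fun _ => 1
  | n + 2 => fun s => deriv (g n) (orbit g y (n + 1) s) * orbitDeriv g y (n + 1) s -
      orbitDeriv g y n s

/-- The second derivative of `orbit` in the parameter. -/
noncomputable def orbitDeriv2 (g : ℕ → ℝ → ℝ) (y : ℝ) : ℕ → ℝ → ℝ
  | 0 => fun _ => 0
  | 1 => fun _ => 0
  | n + 2 => fun s => deriv (deriv (g n)) (orbit g y (n + 1) s) * orbitDeriv g y (n + 1) s ^ 2 +
      deriv (g n) (orbit g y (n + 1) s) * orbitDeriv2 g y (n + 1) s - orbitDeriv2 g y n s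

lemma hasDerivAt_orbit {g : ℕ → ℝ → ℝ} (hg : ∀ n, Differentiable ℝ (g n)) (y : ℝ) (n : ℕ) (s : ℝ) :
    HasDerivAt (orbit g y n) (orbitDeriv g y n s) s := by
  induction n using Nat.twoStepInduction with
  | zero => exact hasDerivAt_const s y
  | one => exact hasDerivAt_id s
  | more n h1 h2 => exact ((hg n _).hasDerivAt.comp s h2).sub h1

lemma hasDerivAt_orbitDeriv {g : ℕ → ℝ → ℝ} (hg : ∀ n, Differentiable ℝ (g n))
    (hg' : ∀ n, Differentiable ℝ (deriv (g n))) (y : ℝ) (n : ℕ) (s : ℝ) :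
    HasDerivAt (orbitDeriv g y n) (orbitDeriv2 g y n s) s := by
  induction n using Nat.twoStepInduction with
  | zero => exact hasDerivAt_const s 0
  | one => exact hasDerivAt_const s 1
  | more n h1 h2 =>
    have h3 := (hg' n _).hasDerivAt.comp s (hasDerivAt_orbit hg y (n + 1) s)
    refine ((h3.mul h2).sub h1).congr_deriv ?_
    simp only [orbitDeriv2, Function.comp]
    ring

lemma continuous_orbit {g : ℕ → ℝ → ℝ} (hg : ∀ n, Differentiable ℝ (g n)) (y : ℝ) (n : ℕ) :
    Continuous (orbit g y n) :=
  continuous_iff_continuousAt.2 fun s => (hasDerivAt_orbit hg y n s).continuousAt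

/-- Moving once around the horizontal circle changes each term of the orbit by an integer. -/
lemma exists_orbit_add_one {g : ℕ → ℝ → ℝ} (hg : ∀ n, ∃ d : ℤ, ∀ x, g n (x + 1) = g n x + d)
    (y : ℝ) (n : ℕ) : ∃ d : ℤ, ∀ s, orbit g y n (s + 1) = orbit g y n s + d := by
  induction n using Nat.twoStepInduction with
  | zero => exact ⟨0, fun s => by simp [orbit]⟩
  | one => exact ⟨1, fun s => by simp [orbit]⟩
  | more n h1 h2 =>
    obtain ⟨a, ha⟩ := h1
    obtain ⟨b, hb⟩ := h2
    obtain ⟨d, hd⟩ := hg n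
    have key : ∀ (k : ℤ) (x : ℝ), g n (x + k) = g n x + d * k := by
      have hnat : ∀ (k : ℕ) (x : ℝ), g n (x + k) = g n x + d * k := by
        intro k
        induction k with
        | zero => simp
        | succ k ih => intro x; push_cast; rw [← add_assoc, hd, ih]; ring
      intro k x
      obtain ⟨k, rfl | rfl⟩ := k.eq_nat_or_neg
      · exact_mod_cast hnat k x
      · have := hnat k (x - k)
        push_cast
        rw [sub_add_cancel] at this
        rw [this, ← sub_eq_add_neg]; ring
    refine ⟨d * b - a, fun s => ?_⟩
    simp only [orbit]
    rw [ha, hb, key]; push_cast; ring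

lemma deriv_add_one {g : ℝ → ℝ} {c : ℝ} (hg : ∀ x, g (x + 1) = g x + c) (x : ℝ) :
    deriv g (x + 1) = deriv g x := by
  rw [← deriv_comp_add_const]
  simp [hg]

lemma apply_add_int {E : Type*} {h : ℝ → E} (hh : ∀ x, h (x + 1) = h x) (x : ℝ) (k : ℤ) :
    h (x + k) = h x := by
  simpa using (show Function.Periodic h 1 from hh).int_mul k x

lemma orbitDeriv_add_one {g : ℕ → ℝ → ℝ} (hg : ∀ n, ∃ d : ℤ, ∀ x, g n (x + 1) = g n x + d)
    (y : ℝ) (n : ℕ) (s : ℝ) : orbitDeriv g y n (s + 1) = orbitDeriv g y n s := by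
  induction n using Nat.twoStepInduction with
  | zero => rfl
  | one => rfl
  | more n h1 h2 =>
    obtain ⟨b, hb⟩ := exists_orbit_add_one hg y (n + 1)
    obtain ⟨d, hd⟩ := hg n
    simp only [orbitDeriv]
    rw [h1, h2, hb, apply_add_int (deriv_add_one hd)]

/-! ### Primitives in the first variable -/

/-- The primitive in the first variable of `h` minus its mean over the first variable. -/
noncomputable def centeredPrimitive (h : ℝ × ℝ → ℂ) (p : ℝ × ℝ) : ℂ :=
  (∫ v in (0 : ℝ)..p.1, h (v, p.2)) - p.1 • ∫ v in (0 : ℝ)..1, h (v, p.2)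

lemma hasDerivAt_integral_fst {h : ℝ × ℝ → ℂ} (hh : ContDiff ℝ 1 h) {B : ℝ}
    (hB : ∀ p, ‖fderiv ℝ h p‖ ≤ B) (x y : ℝ) :
    HasDerivAt (fun y => ∫ v in (0 : ℝ)..x, h (v, y))
      (∫ v in (0 : ℝ)..x, fderiv ℝ h (v, y) (0, 1)) y := by
  have hc := hh.continuous
  have hc' : Continuous (fderiv ℝ h) := hh.continuous_fderiv one_ne_zero
  refine (intervalIntegral.hasDerivAt_integral_of_dominated_loc_of_deriv_le
    (F := fun y v => h (v, y)) (F' := fun y v => fderiv ℝ h (v, y) (0, 1)) (bound := fun _ => B)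
    univ_mem (Eventually.of_forall fun y' => ?_) ?_ ?_ ?_ ?_ ?_).2
  · exact (by fun_prop : Continuous fun v => h (v, y')).aestronglyMeasurable
  · exact (by fun_prop : Continuous fun v => h (v, y)).intervalIntegrable _ _
  · exact (by fun_prop : Continuous fun v => fderiv ℝ h (v, y) (0, 1)).aestronglyMeasurable
  · refine Eventually.of_forall fun v _ y' _ => ?_
    refine (ContinuousLinearMap.le_opNorm _ _).trans ?_
    simpa using hB (v, y')
  · exact intervalIntegrable_const
  · refine Eventually.of_forall fun v _ y' _ => ?_
    have h1 : HasFDerivAt h (fderiv ℝ h (v, y')) (v, y') :=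
      (hh.differentiable one_ne_zero _).hasFDerivAt
    exact h1.comp_hasDerivAt y' ((hasDerivAt_const y' v).prodMk (hasDerivAt_id y'))

lemma hasFDerivAt_integral_fst {h : ℝ × ℝ → ℂ} (hh : ContDiff ℝ 1 h) {B : ℝ}
    (hB : ∀ p, ‖fderiv ℝ h p‖ ≤ B) (p : ℝ × ℝ) :
    HasFDerivAt (fun p : ℝ × ℝ => ∫ v in (0 : ℝ)..p.1, h (v, p.2))
      ((ContinuousLinearMap.toSpanSingleton ℝ (h p)).coprod
        (ContinuousLinearMap.toSpanSingleton ℝ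
          (∫ v in (0 : ℝ)..p.1, fderiv ℝ h (v, p.2) (0, 1)))) p := by
  have hc := hh.continuous
  have hc' : Continuous (fderiv ℝ h) := hh.continuous_fderiv one_ne_zero
  have hT : Continuous fun z : ℂ => ContinuousLinearMap.toSpanSingleton ℝ z :=
    (ContinuousLinearMap.toSpanSingletonCLE (𝕜 := ℝ) (E := ℂ)).continuous
  refine (hasStrictFDerivAt_uncurry_coprod (f := fun x y => ∫ v in (0 : ℝ)..x, h (v, y))
    (f₁ := fun x y => ContinuousLinearMap.toSpanSingleton ℝ (h (x, y)))
    (f₂ := fun x y => ContinuousLinearMap.toSpanSingleton ℝ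
          (∫ v in (0 : ℝ)..x, fderiv ℝ h (v, y) (0, 1)))
    (Eventually.of_forall fun v => ?_) (Eventually.of_forall fun v => ?_) ?_ ?_).hasFDerivAt
  · have : Continuous fun u => h (u, v.2) := by fun_prop
    exact (this.integral_hasStrictDerivAt 0 v.1).hasDerivAt.hasFDerivAt
  · exact (hasDerivAt_integral_fst hh hB v.1 v.2).hasFDerivAt
  · exact (hT.comp hc).continuousAt
  · refine (hT.comp ?_).continuousAt
    refine intervalIntegral.continuous_parametric_intervalIntegral_of_continuous
      (f := fun p : ℝ × ℝ => fun v => fderiv ℝ h (v, p.2) (0, 1)) (μ := volume) (a₀ := 0)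
      (s := Prod.fst) ?_ continuous_fst
    simp only [Function.uncurry_def]
    fun_prop

lemma centeredPrimitive_add_one {h : ℝ × ℝ → ℂ} (hh : Continuous h)
    (hp : ∀ x y, h (x + 1, y) = h (x, y)) (x y : ℝ) :
    centeredPrimitive h (x + 1, y) = centeredPrimitive h (x, y) := by
  have hc : Continuous fun u => h (u, y) := by fun_prop
  have hper : Function.Periodic (fun u => h (u, y)) 1 := fun u => hp u y
  simp only [centeredPrimitive]
  rw [← intervalIntegral.integral_add_adjacent_intervals (hc.intervalIntegrable 0 x)
    (hc.intervalIntegrable x (x + 1)), hper.intervalIntegral_add_eq x 0, zero_add, add_smul,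
    one_smul]
  ring

lemma norm_integral_le_of_abs_le {h : ℝ → ℂ} {B x : ℝ} (hB : ∀ v, ‖h v‖ ≤ B) (hx0 : 0 ≤ x)
    (hx : x ≤ 1) : ‖∫ v in (0 : ℝ)..x, h v‖ ≤ B := by
  have hB0 : 0 ≤ B := (norm_nonneg _).trans (hB 0)
  refine (intervalIntegral.norm_integral_le_of_norm_le_const fun v _ => hB v).trans ?_
  rw [sub_zero, abs_of_nonneg hx0]
  nlinarith

lemma centeredPrimitive_add_int {h : ℝ × ℝ → ℂ} (hh : Continuous h)
    (hp : ∀ x y, h (x + 1, y) = h (x, y)) (x y : ℝ) (k : ℤ) :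
    centeredPrimitive h (x + k, y) = centeredPrimitive h (x, y) :=
  apply_add_int (h := fun x => centeredPrimitive h (x, y))
    (fun x => centeredPrimitive_add_one hh hp x y) x k

lemma norm_centeredPrimitive_le {h : ℝ × ℝ → ℂ} (hh : Continuous h)
    (hp : ∀ x y, h (x + 1, y) = h (x, y)) (h1 : ∀ p, ‖h p‖ ≤ 1) (p : ℝ × ℝ) :
    ‖centeredPrimitive h p‖ ≤ 2 := by
  obtain ⟨x, y⟩ := p
  rw [← Int.fract_add_floor x, centeredPrimitive_add_int hh hp]
  have a1 := norm_integral_le_of_abs_le (h := fun v => h (v, y)) (fun v => h1 _)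
    (Int.fract_nonneg x) (Int.fract_lt_one x).le
  have a2 := norm_integral_le_of_abs_le (h := fun v => h (v, y)) (fun v => h1 _)
    zero_le_one le_rfl
  refine (norm_sub_le _ _).trans ?_
  rw [norm_smul, Real.norm_eq_abs, abs_of_nonneg (Int.fract_nonneg x)]
  have := Int.fract_lt_one x
  have := Int.fract_nonneg x
  nlinarith [norm_nonneg (∫ v in (0 : ℝ)..1, h (v, y))]

/-- The derivative of the centered primitive along a curve is `h` minus its mean, up to a multiple
of the speed of the second coordinate. -/
lemma hasDerivAt_centeredPrimitive_comp {h : ℝ × ℝ → ℂ} (hh : ContDiff ℝ 1 h) {B : ℝ}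
    (hp : ∀ x y, h (x + 1, y) = h (x, y)) (hB : ∀ p, ‖fderiv ℝ h p‖ ≤ B) {x y : ℝ → ℝ}
    {x' y' s : ℝ} (hx : HasDerivAt x x' s) (hy : HasDerivAt y y' s) :
    ∃ E : ℂ, ‖E‖ ≤ 2 * B ∧ HasDerivAt (fun s => centeredPrimitive h (x s, y s))
      (x' • (h (x s, y s) - ∫ v in (0 : ℝ)..1, h (v, y s)) + y' • E) s := by
  set k : ℤ := ⌊x s⌋ with hk
  have hxk : HasDerivAt (fun s => x s - k) x' s := hx.sub_const _
  have hfr : x s - k = Int.fract (x s) := rfl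
  have h1 := (hasFDerivAt_integral_fst hh hB (x s - k, y s)).comp_hasDerivAt s (hxk.prodMk hy)
  have h2 := (hasDerivAt_integral_fst hh hB 1 (y s)).scomp s hy
  have h3 := h1.sub (hxk.smul h2)
  have hbd : ∀ v, ‖fderiv ℝ h (v, y s) (0, 1)‖ ≤ B := fun v => by
    refine (ContinuousLinearMap.le_opNorm _ _).trans ?_
    simpa using hB (v, y s)
  refine ⟨(∫ v in (0 : ℝ)..(x s - k), fderiv ℝ h (v, y s) (0, 1)) -
    (x s - k) • ∫ v in (0 : ℝ)..1, fderiv ℝ h (v, y s) (0, 1), ?_, ?_⟩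
  · have a1 := norm_integral_le_of_abs_le hbd (Int.fract_nonneg (x s)) (Int.fract_lt_one _).le
    have a2 := norm_integral_le_of_abs_le hbd zero_le_one le_rfl
    have := Int.fract_lt_one (x s)
    have := Int.fract_nonneg (x s)
    rw [hfr]
    refine (norm_sub_le _ _).trans ?_
    rw [norm_smul, Real.norm_eq_abs, abs_of_nonneg (Int.fract_nonneg (x s))]
    nlinarith [norm_nonneg (∫ v in (0 : ℝ)..1, fderiv ℝ h (v, y s) (0, 1))]
  · have hfun : (fun s => centeredPrimitive h (x s, y s)) =
        fun s => centeredPrimitive h (x s - k, y s) := by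
      funext s
      have := centeredPrimitive_add_int hh.continuous hp (x s - k) (y s) k
      rwa [sub_add_cancel] at this
    have hval : h (x s - k, y s) = h (x s, y s) := by
      have := apply_add_int (h := fun v => h (v, y s)) (fun v => hp v (y s)) (x s - k) k
      simp only [sub_add_cancel] at this
      exact this.symm
    rw [hfun]
    refine h3.congr_deriv ?_
    simp only [ContinuousLinearMap.coprod_apply, ContinuousLinearMap.toSpanSingleton_apply, hval,
      Function.comp]
    simp only [Complex.real_smul]
    ring

/-! ### Decorrelation along horizontal lines -/

/-- The product of the observables `q i` along pairs of consecutive terms of the orbit. -/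
noncomputable def weight (q : ℕ → ℝ × ℝ → ℂ) (g : ℕ → ℝ → ℝ) (y : ℝ) (n : ℕ) (s : ℝ) : ℂ :=
  ∏ i ∈ Finset.range n, q i (orbit g y (i + 1) s, orbit g y i s)

lemma norm_weight_le_one {q : ℕ → ℝ × ℝ → ℂ} (hq1 : ∀ i p, ‖q i p‖ ≤ 1) (g : ℕ → ℝ → ℝ) (y : ℝ)
    (n : ℕ) (s : ℝ) : ‖weight q g y n s‖ ≤ 1 := by
  rw [weight, norm_prod]
  exact Finset.prod_le_one (fun _ _ => norm_nonneg _) fun i _ => hq1 i _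

lemma hasDerivAt_weight {q : ℕ → ℝ × ℝ → ℂ} {g : ℕ → ℝ → ℝ} (hg : ∀ n, Differentiable ℝ (g n))
    (hq : ∀ i, Differentiable ℝ (q i)) {B : ℝ} (hqB : ∀ i p, ‖fderiv ℝ (q i) p‖ ≤ B)
    (hq1 : ∀ i p, ‖q i p‖ ≤ 1) (y : ℝ) (n : ℕ) (s : ℝ)
    (hmono : ∀ i < n, |orbitDeriv g y i s| ≤ |orbitDeriv g y (i + 1) s|) :
    ∃ W : ℂ, HasDerivAt (weight q g y n) W s ∧
      ‖W‖ ≤ B * ∑ i ∈ Finset.range (n + 1), |orbitDeriv g y i s| := by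
  induction n with
  | zero =>
    refine ⟨0, ?_, ?_⟩
    · simpa [weight] using! hasDerivAt_const s (1 : ℂ)
    · simp [orbitDeriv]
  | succ n ih =>
    obtain ⟨W, hW, hWB⟩ := ih fun i hi => hmono i (by omega)
    have h1 := (hq n (orbit g y (n + 1) s, orbit g y n s)).hasFDerivAt.comp_hasDerivAt s
      ((hasDerivAt_orbit hg y (n + 1) s).prodMk (hasDerivAt_orbit hg y n s))
    refine ⟨_, (hW.mul h1).congr_of_eventuallyEq
      (Eventually.of_forall fun s => Finset.prod_range_succ _ n), ?_⟩
    rw [Finset.sum_range_succ, mul_add]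
    refine (norm_add_le _ _).trans (add_le_add ?_ ?_)
    · rw [norm_mul]
      exact (mul_le_of_le_one_right (norm_nonneg _) (hq1 n _)).trans hWB
    · rw [norm_mul]
      refine (mul_le_of_le_one_left (norm_nonneg _) (norm_weight_le_one hq1 _ _ _ _)).trans ?_
      refine (ContinuousLinearMap.le_opNorm _ _).trans ?_
      refine mul_le_mul (hqB n _) ?_ (norm_nonneg _) ((norm_nonneg _).trans (hqB n (0, 0)))
      simp [Prod.norm_def, hmono n (by omega)]

lemma continuous_weight {q : ℕ → ℝ × ℝ → ℂ} {g : ℕ → ℝ → ℝ} (hg : ∀ n, Differentiable ℝ (g n))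
    (hq : ∀ i, Continuous (q i)) (y : ℝ) (n : ℕ) : Continuous (weight q g y n) :=
  continuous_finsetProd _ fun i _ =>
    (hq i).comp ((continuous_orbit hg y (i + 1)).prodMk (continuous_orbit hg y i))

lemma apply_add_int_int {E : Type*} {h : ℝ × ℝ → E} (hx : ∀ x y, h (x + 1, y) = h (x, y))
    (hy : ∀ x y, h (x, y + 1) = h (x, y)) (x y : ℝ) (k l : ℤ) : h (x + k, y + l) = h (x, y) := by
  rw [apply_add_int (h := fun x => h (x, y + l)) (fun x => hx x _),
    apply_add_int (h := fun y => h (x, y)) (fun y => hy x y)]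

lemma weight_add_one {q : ℕ → ℝ × ℝ → ℂ} {g : ℕ → ℝ → ℝ}
    (hdeg : ∀ n, ∃ d : ℤ, ∀ x, g n (x + 1) = g n x + d)
    (hqx : ∀ i x y, q i (x + 1, y) = q i (x, y)) (hqy : ∀ i x y, q i (x, y + 1) = q i (x, y))
    (y : ℝ) (n : ℕ) (s : ℝ) : weight q g y n (s + 1) = weight q g y n s := by
  refine Finset.prod_congr rfl fun i _ => ?_
  obtain ⟨a, ha⟩ := exists_orbit_add_one hdeg y (i + 1)
  obtain ⟨b, hb⟩ := exists_orbit_add_one hdeg y i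
  rw [ha, hb, apply_add_int_int (hqx i) (hqy i)]

lemma continuous_mean {h : ℝ × ℝ → ℂ} (hh : ContDiff ℝ 1 h) {B : ℝ}
    (hB : ∀ p, ‖fderiv ℝ h p‖ ≤ B) : Continuous fun y => ∫ v in (0 : ℝ)..1, h (v, y) :=
  continuous_iff_continuousAt.2 fun y => (hasDerivAt_integral_fst hh hB 1 y).continuousAt

/-- The division of the weight by the derivative of the orbit turns, up to a small error, the
centered observable into an exact derivative. The weight vanishes where the orbit may fail to
expand. -/
lemma exists_hasDerivAt_weight_div {q : ℕ → ℝ × ℝ → ℂ} {g : ℕ → ℝ → ℝ} {h : ℝ × ℝ → ℂ}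
    {ρ Q : ℕ → ℝ} {r κ B : ℝ} (hg : ∀ n, ContDiff ℝ 2 (g n)) (hr : 2 ≤ r) (hκ0 : 0 ≤ κ)
    (hκ : κ ≤ 1 / 4) (hρ : ∀ i, 2 * r ≤ ρ i) (hQ1 : ∀ i x, |deriv (g i) x| ≤ Q i)
    (hQ2 : ∀ i x, |deriv (deriv (g i)) x| ≤ Q i) (hQρ : ∀ i, 4 * Q i ≤ κ * ρ i ^ 2)
    (hq : ∀ i, Differentiable ℝ (q i)) (hqB : ∀ i p, ‖fderiv ℝ (q i) p‖ ≤ B)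
    (hq1 : ∀ i p, ‖q i p‖ ≤ 1) (hq0 : ∀ i p, |deriv (g i) p.1| < ρ i → q i p = 0)
    (hh : ContDiff ℝ 1 h) (hhB : ∀ p, ‖fderiv ℝ h p‖ ≤ B) (hh1 : ∀ p, ‖h p‖ ≤ 1)
    (hhx : ∀ x y, h (x + 1, y) = h (x, y)) (y : ℝ) (n : ℕ) (s : ℝ) :
    ∃ D : ℂ, ‖D‖ ≤ 10 * B / r + 4 * κ ∧
      HasDerivAt (fun s => (orbitDeriv g y (n + 1) s)⁻¹ • (weight q g y n s *
          centeredPrimitive h (orbit g y (n + 1) s, orbit g y n s)))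
        (weight q g y n s * (h (orbit g y (n + 1) s, orbit g y n s) -
          ∫ v in (0 : ℝ)..1, h (v, orbit g y n s)) + D) s := by
  have hr0 : 0 < r := by linarith
  have hB0 : 0 ≤ B := (norm_nonneg _).trans (hhB (0, 0))
  have hg1 : ∀ n, Differentiable ℝ (g n) := fun n => (hg n).differentiable two_ne_zero
  have hg2 : ∀ n, ContDiff ℝ 1 (deriv (g n)) := fun n => (contDiff_succ_iff_deriv.1 (hg n)).2.2
  have hg2' : ∀ n, Differentiable ℝ (deriv (g n)) := fun n => (hg2 n).differentiable one_ne_zero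
  by_cases hgood : ∀ i < n, ρ i ≤ |deriv (g i) (orbit g y (i + 1) s)|
  · have hc : ∀ i < n, 2 * r ≤ |deriv (g i) (orbit g y (i + 1) s)| :=
      fun i hi => (hρ i).trans (hgood i hi)
    have hu : ∀ i, orbitDeriv g y (i + 2) s = deriv (g i) (orbit g y (i + 1) s) *
      orbitDeriv g y (i + 1) s - orbitDeriv g y i s := fun i => rfl
    have hexp : ∀ i ≤ n, _ := fun i hi => expansion_of_recursion hr
      (u := fun i => orbitDeriv g y i s) rfl rfl hu hc hi
    have hsum := sum_abs_le_of_recursion hr (u := fun i => orbitDeriv g y i s) rfl rfl hu hc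
      le_rfl
    have hdist := (distortion_of_recursion hr (u := fun i => orbitDeriv g y i s)
      (w := fun i => orbitDeriv2 g y i s)
      (d := fun i => deriv (deriv (g i)) (orbit g y (i + 1) s)) rfl rfl hu hc rfl rfl
      (fun i => rfl) hκ0 hκ (fun i _ => hQ1 i _) (fun i _ => hQ2 i _)
      (fun i hi => (hQρ i).trans (by
        have := (by linarith [hρ i] : 0 ≤ ρ i)
        have := hgood i hi
        gcongr)) le_rfl).2
    have hmono : ∀ i < n, |orbitDeriv g y i s| ≤ |orbitDeriv g y (i + 1) s| := fun i hi => by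
      have := (hexp i hi.le).1
      nlinarith [abs_nonneg (orbitDeriv g y i s)]
    obtain ⟨W, hW, hWB⟩ := hasDerivAt_weight hg1 hq hqB hq1 y n s hmono
    obtain ⟨E, hE, hΦ⟩ := hasDerivAt_centeredPrimitive_comp hh hhx hhB
      (hasDerivAt_orbit hg1 y (n + 1) s) (hasDerivAt_orbit hg1 y n s)
    obtain ⟨hun, hu0⟩ := hexp n le_rfl
    have hinv := (hasDerivAt_orbitDeriv hg1 hg2' y (n + 1) s).inv (abs_pos.1 hu0)
    have hA1 := norm_weight_le_one hq1 g y n s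
    have hΦ1 := norm_centeredPrimitive_le hh.continuous hhx hh1
      (orbit g y (n + 1) s, orbit g y n s)
    set u := orbitDeriv g y (n + 1) s with hu_def
    set v := orbitDeriv g y n s
    set w := orbitDeriv2 g y (n + 1) s
    set A := weight q g y n s
    set H := centeredPrimitive h (orbit g y (n + 1) s, orbit g y n s)
    have hu0' : u ≠ 0 := abs_pos.1 hu0
    refine ⟨u⁻¹ • (W * H) + (v / u) • (A * E) + (-w / u ^ 2) • (A * H), ?_,
      (hinv.smul (hW.mul hΦ)).congr_deriv ?_⟩
    · have b1 : ‖u⁻¹ • (W * H)‖ ≤ 4 * B / r := by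
        rw [norm_smul, norm_mul, norm_inv, Real.norm_eq_abs]
        have : ‖W‖ ≤ B * (2 / r * |u|) := hWB.trans (by gcongr)
        calc |u|⁻¹ * (‖W‖ * ‖H‖) ≤ |u|⁻¹ * ((B * (2 / r * |u|)) * 2) := by gcongr
          _ = 4 * B / r := by field_simp; ring
      have b2 : ‖(v / u) • (A * E)‖ ≤ 2 * B / r := by
        rw [norm_smul, norm_mul, norm_div, Real.norm_eq_abs, Real.norm_eq_abs]
        have : |v| / |u| ≤ 1 / r := by
          rw [div_le_div_iff₀ hu0 hr0]
          linarith
        calc |v| / |u| * (‖A‖ * ‖E‖) ≤ 1 / r * (1 * (2 * B)) := by gcongr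
          _ = 2 * B / r := by ring
      have b3 : ‖(-w / u ^ 2) • (A * H)‖ ≤ 4 * κ := by
        rw [norm_smul, norm_mul, norm_div, norm_neg, norm_pow, Real.norm_eq_abs, Real.norm_eq_abs,
          sq_abs]
        have : |w| / u ^ 2 ≤ 2 * κ := by
          rw [div_le_iff₀ (by positivity)]
          exact hdist
        calc |w| / u ^ 2 * (‖A‖ * ‖H‖) ≤ 2 * κ * (1 * 2) := by gcongr
          _ = 4 * κ := by ring
      have b4 : 10 * B / r = 4 * B / r + 2 * B / r + 4 * B / r := by ring
      have b5 : 0 ≤ 4 * B / r := by positivity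
      refine (norm_add₃_le).trans ?_
      linarith
    · have hu0c : (u : ℂ) ≠ 0 := by exact_mod_cast hu0'
      change u⁻¹ • (W * H + A * (u • (h (orbit g y (n + 1) s, orbit g y n s) -
        ∫ v in (0 : ℝ)..1, h (v, orbit g y n s)) + v • E)) + (-w / u ^ 2) • (A * H) = _
      simp only [Complex.real_smul]
      push_cast
      field_simp
      ring
  · push Not at hgood
    obtain ⟨i, hi, hlt⟩ := hgood
    have hzero : ∀ s, |deriv (g i) (orbit g y (i + 1) s)| < ρ i → weight q g y n s = 0 :=
      fun s hs => Finset.prod_eq_zero (Finset.mem_range.2 hi) (hq0 i _ hs)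
    have hcont : Continuous fun s => |deriv (g i) (orbit g y (i + 1) s)| :=
      ((hg2 i).continuous.comp (continuous_orbit hg1 y (i + 1))).abs
    have hev : ∀ᶠ s' in 𝓝 s, weight q g y n s' = 0 :=
      (hcont.continuousAt.eventually_lt continuousAt_const hlt).mono hzero
    refine ⟨0, by rw [norm_zero]; positivity, ?_⟩
    rw [hzero s hlt]
    refine ((hasDerivAt_const s (0 : ℂ)).congr_of_eventuallyEq ?_).congr_deriv (by simp)
    filter_upwards [hev] with s' hs'
    simp [hs']

/-- Decorrelation: the weight of an orbit up to time `n` is almost uncorrelated, on each horizontal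
line, with centered observables of the next step. -/
lemma norm_integral_weight_mul_le {q : ℕ → ℝ × ℝ → ℂ} {g : ℕ → ℝ → ℝ} {h : ℝ × ℝ → ℂ}
    {ρ Q : ℕ → ℝ} {r κ B : ℝ} (hg : ∀ n, ContDiff ℝ 2 (g n))
    (hdeg : ∀ n, ∃ d : ℤ, ∀ x, g n (x + 1) = g n x + d) (hr : 2 ≤ r) (hκ0 : 0 ≤ κ)
    (hκ : κ ≤ 1 / 4) (hρ : ∀ i, 2 * r ≤ ρ i) (hQ1 : ∀ i x, |deriv (g i) x| ≤ Q i)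
    (hQ2 : ∀ i x, |deriv (deriv (g i)) x| ≤ Q i) (hQρ : ∀ i, 4 * Q i ≤ κ * ρ i ^ 2)
    (hq : ∀ i, Differentiable ℝ (q i)) (hqB : ∀ i p, ‖fderiv ℝ (q i) p‖ ≤ B)
    (hq1 : ∀ i p, ‖q i p‖ ≤ 1) (hq0 : ∀ i p, |deriv (g i) p.1| < ρ i → q i p = 0)
    (hqx : ∀ i x y, q i (x + 1, y) = q i (x, y)) (hqy : ∀ i x y, q i (x, y + 1) = q i (x, y))
    (hh : ContDiff ℝ 1 h) (hhB : ∀ p, ‖fderiv ℝ h p‖ ≤ B) (hh1 : ∀ p, ‖h p‖ ≤ 1)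
    (hhx : ∀ x y, h (x + 1, y) = h (x, y)) (hhy : ∀ x y, h (x, y + 1) = h (x, y))
    (y : ℝ) (n : ℕ) :
    ‖∫ s in (0 : ℝ)..1, weight q g y n s * (h (orbit g y (n + 1) s, orbit g y n s) -
      ∫ v in (0 : ℝ)..1, h (v, orbit g y n s))‖ ≤ 10 * B / r + 4 * κ := by
  have hg1 : ∀ n, Differentiable ℝ (g n) := fun n => (hg n).differentiable two_ne_zero
  choose D hD hΨ using exists_hasDerivAt_weight_div hg hr hκ0 hκ hρ hQ1 hQ2 hQρ hq hqB hq1 hq0 hh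
    hhB hh1 hhx y n
  set Ψ := fun s => (orbitDeriv g y (n + 1) s)⁻¹ • (weight q g y n s *
          centeredPrimitive h (orbit g y (n + 1) s, orbit g y n s)) with hΨ_def
  set G := fun s => weight q g y n s * (h (orbit g y (n + 1) s, orbit g y n s) -
      ∫ v in (0 : ℝ)..1, h (v, orbit g y n s))
  have hG : Continuous G := (continuous_weight hg1 (fun i => (hq i).continuous) y n).mul
    ((hh.continuous.comp ((continuous_orbit hg1 y (n + 1)).prodMk (continuous_orbit hg1 y n))).sub
      ((continuous_mean hh hhB).comp (continuous_orbit hg1 y n)))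
  have hper : Ψ 1 = Ψ 0 := by
    obtain ⟨a, ha⟩ := exists_orbit_add_one hdeg y (n + 1)
    obtain ⟨b, hb⟩ := exists_orbit_add_one hdeg y n
    have h0 := weight_add_one hdeg hqx hqy y n 0
    have h1 := orbitDeriv_add_one hdeg y (n + 1) 0
    have h2 := ha 0
    have h3 := hb 0
    rw [zero_add] at h0 h1 h2 h3
    have h4 := apply_add_int_int (h := centeredPrimitive h)
      (fun x y => centeredPrimitive_add_one hh.continuous hhx x y)
      (fun x y => by simp only [centeredPrimitive, hhy])
      (orbit g y (n + 1) 0) (orbit g y n 0) a b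
    simp only [hΨ_def, h0, h1, h2, h3, h4]
  have key := norm_image_sub_le_of_norm_deriv_le_segment_01'
    (f := fun s => Ψ s - ∫ s' in (0 : ℝ)..s, G s') (f' := D) (C := 10 * B / r + 4 * κ)
    (fun s _ => (((hΨ s).sub (hG.integral_hasStrictDerivAt 0 s).hasDerivAt).congr_deriv
      (by simp only [G]; ring)).hasDerivWithinAt) (fun s _ => hD s)
  simpa only [hper, intervalIntegral.integral_same, sub_zero, sub_sub_cancel_left, norm_neg]
    using key

/-! ### Smoothing on the torus -/

open scoped Convolution in
/-- Mollification of a Hölder function on the torus at scale `ε`: the error is of order `ε ^ α`, and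
the derivative of order `1 / ε`. -/
lemma exists_smooth_approx {m : Torus2 → ℝ} {α K : ℝ≥0} {C : ℝ} (hα : 0 < α) (hm : HolderWith K α m)
    (hmC : ∀ p, |m p| ≤ C) :
    ∃ C' : ℝ, 0 < C' ∧ ∀ ε : ℝ, 0 < ε → ε ≤ 1 → ∃ M : ℝ × ℝ → ℝ, ContDiff ℝ 1 M ∧
      (∀ p, ‖fderiv ℝ M p‖ ≤ C' / ε) ∧
      (∀ x y : ℝ, |M (x, y) - m ((x : UnitAddCircle), (y : UnitAddCircle))| ≤
        K * ε ^ (α : ℝ)) ∧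
      (∀ x y, M (x + 1, y) = M (x, y)) ∧ (∀ x y, M (x, y + 1) = M (x, y)) := by
  set ρ : ContDiffBump (0 : ℝ × ℝ) := ⟨1 / 2, 1, by norm_num, by norm_num⟩
  set ρn := ρ.normed (volume : Measure (ℝ × ℝ))
  set T := (ContinuousLinearMap.lsmul ℝ ℝ : ℝ →L[ℝ] ℝ →L[ℝ] ℝ)
  have hC0 : 0 ≤ C := (abs_nonneg _).trans (hmC (0, 0))
  have hρc : HasCompactSupport ρn := ρ.hasCompactSupport_normed
  have hρs : ContDiff ℝ 1 ρn := ρ.contDiff_normed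
  have hint : Integrable (fun t => ‖fderiv ℝ ρn t‖) :=
    ((hρs.continuous_fderiv one_ne_zero).integrable_of_hasCompactSupport (hρc.fderiv ℝ)).norm
  set J := ∫ t, ‖fderiv ℝ ρn t‖
  have hJ : 0 ≤ J := integral_nonneg fun t => norm_nonneg _
  refine ⟨C * J + 1, by positivity, fun ε hε hε1 => ?_⟩
  have hproj : Continuous fun p : ℝ × ℝ => ((p.1 : UnitAddCircle), (p.2 : UnitAddCircle)) :=
    ((AddCircle.continuous_mk' 1).comp continuous_fst).prodMk
      ((AddCircle.continuous_mk' 1).comp continuous_snd)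
  set g : ℝ × ℝ → ℝ := fun p => m (((ε * p.1 : ℝ) : UnitAddCircle), ((ε * p.2 : ℝ) : UnitAddCircle))
  have hg : Continuous g := (hm.continuous hα).comp
    (hproj.comp (by fun_prop : Continuous fun p : ℝ × ℝ => (ε * p.1, ε * p.2)))
  set G := ρn ⋆[T, volume] g
  have hG : ContDiff ℝ 1 G := hρc.contDiff_convolution_left T (n := 1) hρs hg.locallyIntegrable
  have hG' : ∀ p, ‖fderiv ℝ G p‖ ≤ C * J := fun p => by
    rw [(hρc.hasFDerivAt_convolution_left T hρs hg.locallyIntegrable p).fderiv]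
    refine (norm_integral_le_of_norm_le (hint.const_mul C)
      (Eventually.of_forall fun t => ?_)).trans_eq (integral_const_mul _ _)
    refine ContinuousLinearMap.opNorm_le_bound _ (by positivity) fun v => ?_
    rw [ContinuousLinearMap.precompL_apply]
    change ‖fderiv ℝ ρn t v • g (p - t)‖ ≤ _
    rw [norm_smul]
    have h1 : ‖g (p - t)‖ ≤ C := hmC _
    have h2 := (fderiv ℝ ρn t).le_opNorm v
    calc _ ≤ ‖fderiv ℝ ρn t‖ * ‖v‖ * C := by gcongr
      _ = _ := by ring
  have hshift : ∀ p a : ℝ × ℝ, (∀ x, g (x + a) = g x) → G (p + a) = G p := fun p a ha => by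
    simp only [G, MeasureTheory.convolution]
    refine integral_congr_ae (Eventually.of_forall fun t => ?_)
    simp only
    rw [show p + a - t = (p - t) + a by abel, ha]
  refine ⟨fun p => G (ε⁻¹ • p), hG.comp (contDiff_const_smul _), fun p => ?_, fun x y => ?_,
    fun x y => ?_, fun x y => ?_⟩
  · have h1 : HasFDerivAt (fun p : ℝ × ℝ => ε⁻¹ • p) (ε⁻¹ • ContinuousLinearMap.id ℝ (ℝ × ℝ)) p :=
      (ε⁻¹ • ContinuousLinearMap.id ℝ (ℝ × ℝ)).hasFDerivAt
    have h2 := ((hG.differentiable one_ne_zero (ε⁻¹ • p)).hasFDerivAt.comp p h1).fderiv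
    simp only [Function.comp_def] at h2
    rw [h2, ContinuousLinearMap.comp_smul, ContinuousLinearMap.comp_id, norm_smul, norm_inv,
      Real.norm_eq_abs, abs_of_pos hε, div_eq_inv_mul]
    have := hG' (ε⁻¹ • p)
    gcongr
    linarith
  · have h1 : g (ε⁻¹ • (x, y)) = m ((x : UnitAddCircle), (y : UnitAddCircle)) := by
      simp only [g, Prod.smul_mk, smul_eq_mul, mul_inv_cancel_left₀ hε.ne']
    rw [← h1, ← Real.dist_eq]
    refine ρ.dist_normed_convolution_le hg.aestronglyMeasurable fun p hp => ?_
    refine (hm.dist_le _ _).trans ?_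
    have hp' : dist p (ε⁻¹ • (x, y)) < 1 := hp
    refine mul_le_mul_of_nonneg_left (Real.rpow_le_rpow dist_nonneg ?_ α.2) K.2
    have hcirc : ∀ a b : ℝ, dist (a : UnitAddCircle) (b : UnitAddCircle) ≤ dist a b := fun a b => by
      rw [dist_eq_norm, dist_eq_norm, ← AddCircle.coe_sub]
      exact QuotientAddGroup.norm_mk_le_norm
    rw [Prod.dist_eq] at hp' ⊢
    have h3 := max_lt_iff.1 hp'
    refine max_le ((hcirc _ _).trans ?_) ((hcirc _ _).trans ?_)
    · rw [Real.dist_eq, ← mul_sub, abs_mul, abs_of_pos hε, ← Real.dist_eq]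
      exact mul_le_of_le_one_right hε.le h3.1.le
    · rw [Real.dist_eq, ← mul_sub, abs_mul, abs_of_pos hε, ← Real.dist_eq]
      exact mul_le_of_le_one_right hε.le h3.2.le
  · have := hshift (ε⁻¹ • (x, y)) (ε⁻¹, 0) fun p => by
      simp only [g, Prod.fst_add, Prod.snd_add, mul_add, mul_inv_cancel₀ hε.ne', add_zero]
      rw [AddCircle.coe_add_period]
    refine Eq.trans ?_ this
    simp [mul_add]
  · have := hshift (ε⁻¹ • (x, y)) (0, ε⁻¹) fun p => by
      simp only [g, Prod.fst_add, Prod.snd_add, mul_add, mul_inv_cancel₀ hε.ne', add_zero]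
      rw [AddCircle.coe_add_period]
    refine Eq.trans ?_ this
    simp [mul_add]

/-! ### Functions on the torus and their lifts -/

instance isProbabilityMeasure_circle : IsProbabilityMeasure (volume : Measure UnitAddCircle) :=
  ⟨by simp⟩

instance isProbabilityMeasure_torus : IsProbabilityMeasure (volume : Measure Torus2) :=
  inferInstanceAs (IsProbabilityMeasure ((volume : Measure UnitAddCircle).prod volume))

lemma measurable_rep : Measurable fun x : UnitAddCircle => (AddCircle.equivIco (1 : ℝ) 0 x : ℝ) :=
  measurable_subtype_coe.comp (AddCircle.measurableEquivIco (1 : ℝ) 0).measurable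

/-- The function on the torus with a given doubly periodic lift. -/
noncomputable def descend {E : Type*} (q : ℝ × ℝ → E) (p : Torus2) : E :=
  q (AddCircle.equivIco (1 : ℝ) 0 p.1, AddCircle.equivIco (1 : ℝ) 0 p.2)

lemma measurable_descend {E : Type*} [MeasurableSpace E] {q : ℝ × ℝ → E} (hq : Measurable q) :
    Measurable (descend q) :=
  hq.comp ((measurable_rep.comp measurable_fst).prodMk (measurable_rep.comp measurable_snd))

lemma exists_rep_eq (x : ℝ) :
    ∃ k : ℤ, (AddCircle.equivIco (1 : ℝ) 0 (x : UnitAddCircle) : ℝ) = x + k := by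
  refine ⟨-⌊x⌋, ?_⟩
  rw [AddCircle.coe_equivIco_mk_apply]
  simp [Int.fract, sub_eq_add_neg]

lemma descend_coe {E : Type*} {q : ℝ × ℝ → E} (hx : ∀ x y, q (x + 1, y) = q (x, y))
    (hy : ∀ x y, q (x, y + 1) = q (x, y)) (x y : ℝ) :
    descend q ((x : UnitAddCircle), (y : UnitAddCircle)) = q (x, y) := by
  obtain ⟨k, hk⟩ := exists_rep_eq x
  obtain ⟨l, hl⟩ := exists_rep_eq y
  simp only [descend]
  rw [hk, hl, apply_add_int_int hx hy]

lemma torusMap_coe {f : ℝ → ℝ} (hf : ∃ d : ℤ, ∀ x, f (x + 1) = f x + d) (x y : ℝ) :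
    torusMap f ((x : UnitAddCircle), (y : UnitAddCircle)) =
      (((f x - y : ℝ) : UnitAddCircle), (x : UnitAddCircle)) := by
  obtain ⟨d, hd⟩ := hf
  have hf' : ∀ x, ((f (x + 1) : ℝ) : UnitAddCircle) = (f x : ℝ) := fun x => by
    rw [hd]
    have := apply_add_int (h := fun x : ℝ => (x : UnitAddCircle))
      (fun x => AddCircle.coe_add_period 1 x) (f x) d
    exact this
  obtain ⟨k, hk⟩ := exists_rep_eq x
  simp only [torusMap]
  rw [hk, apply_add_int (h := fun x => ((f x : ℝ) : UnitAddCircle)) hf' x k, AddCircle.coe_sub]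

/-- Consecutive terms of the lifted orbit are the two coordinates of the orbit on the torus. -/
lemma comp_coe {F : ℕ → ℝ → ℝ} (hF : ∀ n, ∃ d : ℤ, ∀ x, F (n + 1) (x + 1) = F (n + 1) x + d)
    (s y : ℝ) (i : ℕ) :
    comp F i ((s : UnitAddCircle), (y : UnitAddCircle)) =
      ((orbit (fun n => F (n + 1)) y (i + 1) s : UnitAddCircle),
        (orbit (fun n => F (n + 1)) y i s : UnitAddCircle)) := by
  induction i with
  | zero => rfl
  | succ i ih =>
    rw [comp, Function.comp, ih, torusMap_coe (hF i)]
    rfl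

lemma measurePreserving_torusMap {f : ℝ → ℝ} (hf : Measurable f) :
    MeasurePreserving (torusMap f) := by
  have hm : Measurable fun x : UnitAddCircle =>
      ((f (AddCircle.equivIco (1 : ℝ) 0 x : ℝ) : ℝ) : UnitAddCircle) :=
    (AddCircle.continuous_mk' 1).measurable.comp (hf.comp measurable_rep)
  have h1 : MeasurePreserving (fun p : Torus2 =>
      (p.1, ((f (AddCircle.equivIco (1 : ℝ) 0 p.1 : ℝ) : ℝ) : UnitAddCircle) - p.2)) :=
    (MeasurePreserving.id volume).skew_product
      (g := fun x y => ((f (AddCircle.equivIco (1 : ℝ) 0 x : ℝ) : ℝ) : UnitAddCircle) - y)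
      ((hm.comp measurable_fst).sub measurable_snd)
      (Eventually.of_forall fun x => (Measure.measurePreserving_sub_left volume _).map_eq)
  exact Measure.measurePreserving_swap.comp h1

lemma measurePreserving_comp {F : ℕ → ℝ → ℝ} (hF : ∀ n, Measurable (F (n + 1))) (n : ℕ) :
    MeasurePreserving (comp F n) := by
  induction n with
  | zero => exact MeasurePreserving.id _
  | succ n ih => exact (measurePreserving_torusMap (hF n)).comp ih

lemma comp_add (F : ℕ → ℝ → ℝ) (k i : ℕ) (p : Torus2) :
    comp F (k + i) p = comp (fun n => F (k + n)) i (comp F k p) := by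
  induction i with
  | zero => rfl
  | succ i ih => rw [← add_assoc, comp, Function.comp, ih]; rfl

lemma integral_circle {E : Type*} [NormedAddCommGroup E] [NormedSpace ℝ E] (G : UnitAddCircle → E) :
    ∫ x, G x = ∫ s in (0 : ℝ)..1, G s := by
  have := UnitAddCircle.intervalIntegral_preimage 0 G
  rw [zero_add] at this
  exact this.symm

lemma norm_integral_torus_le {G : Torus2 → ℂ} (hG : Integrable G) {δ : ℝ}
    (h : ∀ y : ℝ, ‖∫ s in (0 : ℝ)..1, G ((s : UnitAddCircle), (y : UnitAddCircle))‖ ≤ δ) :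
    ‖∫ p, G p‖ ≤ δ := by
  have e : ∫ p, G p = ∫ y, ∫ x, G (x, y) := integral_prod_symm G hG
  rw [e]
  refine (norm_integral_le_of_norm_le_const (C := δ) (Eventually.of_forall fun y => ?_)).trans ?_
  · rw [integral_circle]
    obtain ⟨y, rfl⟩ := QuotientAddGroup.mk_surjective y
    exact h y
  · simp

/-! ### Decorrelation on the torus -/

lemma integrable_of_norm_le {X : Type*} [MeasurableSpace X] {μ : Measure X} [IsFiniteMeasure μ]
    {G : X → ℂ} (hG : Measurable G) {c : ℝ} (hc : ∀ p, ‖G p‖ ≤ c) : Integrable G μ :=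
  Integrable.of_bound hG.aestronglyMeasurable c (Eventually.of_forall hc)

/-- The product of observables along the first `n` points of an orbit on the torus. -/
noncomputable def torusWeight (q : ℕ → ℝ × ℝ → ℂ) (F : ℕ → ℝ → ℝ) (n : ℕ) (p : Torus2) : ℂ :=
  ∏ i ∈ Finset.range n, descend (q i) (comp F i p)

lemma norm_torusWeight_le_one {q : ℕ → ℝ × ℝ → ℂ} (hq1 : ∀ i p, ‖q i p‖ ≤ 1) (F : ℕ → ℝ → ℝ) (n : ℕ)
    (p : Torus2) : ‖torusWeight q F n p‖ ≤ 1 := by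
  rw [torusWeight, norm_prod]
  exact Finset.prod_le_one (fun _ _ => norm_nonneg _) fun i _ => hq1 i _

lemma measurable_torusWeight {q : ℕ → ℝ × ℝ → ℂ} (hq : ∀ i, Measurable (q i)) {F : ℕ → ℝ → ℝ}
    (hF : ∀ n, Measurable (F (n + 1))) (n : ℕ) : Measurable (torusWeight q F n) :=
  Finset.measurable_fun_prod _ fun i _ =>
    (measurable_descend (hq i)).comp (measurePreserving_comp hF i).measurable

/-- The hypotheses under which weights decorrelate: the maps `g i` have first and second
derivatives bounded by `Q i`, and the observables `q i` vanish where the derivative of `g i` is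
smaller than `ρ i`. The numbers `r` and `κ` bound the expansion from below and the distortion from
above. -/
structure Decorrelating (g : ℕ → ℝ → ℝ) (q : ℕ → ℝ × ℝ → ℂ) (ρ Q : ℕ → ℝ) (r κ B : ℝ) : Prop where
  contDiff : ∀ n, ContDiff ℝ 2 (g n)
  degree : ∀ n, ∃ d : ℤ, ∀ x, g n (x + 1) = g n x + d
  two_le : 2 ≤ r
  nonneg : 0 ≤ κ
  le_quarter : κ ≤ 1 / 4
  two_mul_le : ∀ i, 2 * r ≤ ρ i
  deriv_le : ∀ i x, |deriv (g i) x| ≤ Q i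
  deriv2_le : ∀ i x, |deriv (deriv (g i)) x| ≤ Q i
  four_mul_le : ∀ i, 4 * Q i ≤ κ * ρ i ^ 2
  differentiable : ∀ i, Differentiable ℝ (q i)
  fderiv_le : ∀ i p, ‖fderiv ℝ (q i) p‖ ≤ B
  norm_le_one : ∀ i p, ‖q i p‖ ≤ 1
  eq_zero : ∀ i p, |deriv (g i) p.1| < ρ i → q i p = 0
  periodic_fst : ∀ i x y, q i (x + 1, y) = q i (x, y)
  periodic_snd : ∀ i x y, q i (x, y + 1) = q i (x, y)

/-- An observable on the plane of class `C¹`, doubly periodic and bounded by `1`, with derivative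
bounded by `B`. -/
structure Observable (B : ℝ) (h : ℝ × ℝ → ℂ) : Prop where
  contDiff : ContDiff ℝ 1 h
  fderiv_le : ∀ p, ‖fderiv ℝ h p‖ ≤ B
  norm_le_one : ∀ p, ‖h p‖ ≤ 1
  periodic_fst : ∀ x y, h (x + 1, y) = h (x, y)
  periodic_snd : ∀ x y, h (x, y + 1) = h (x, y)

/-- The mean of an observable over its first variable. -/
noncomputable def mean (h : ℝ × ℝ → ℂ) (y : ℝ) : ℂ := ∫ v in (0 : ℝ)..1, h (v, y)

lemma Decorrelating.measurable {F : ℕ → ℝ → ℝ} {q : ℕ → ℝ × ℝ → ℂ} {ρ Q : ℕ → ℝ} {r κ B : ℝ}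
    (H : Decorrelating (fun n => F (n + 1)) q ρ Q r κ B) (n : ℕ) : Measurable (F (n + 1)) :=
  (H.contDiff n).continuous.measurable

lemma Observable.norm_mean_le_one {B : ℝ} {h : ℝ × ℝ → ℂ} (hh : Observable B h) (y : ℝ) :
    ‖mean h y‖ ≤ 1 :=
  norm_integral_le_of_abs_le (fun v => hh.norm_le_one (v, y)) zero_le_one le_rfl

lemma Observable.continuous_mean {B : ℝ} {h : ℝ × ℝ → ℂ} (hh : Observable B h) :
    Continuous (mean h) := StdMap.continuous_mean hh.contDiff hh.fderiv_le

lemma Observable.mean_add_one {B : ℝ} {h : ℝ × ℝ → ℂ} (hh : Observable B h) (y : ℝ) :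
    mean h (y + 1) = mean h y := by simp only [mean, hh.periodic_snd]

/-- The mean over the first variable, read as a function of the first coordinate: the previous step
of the orbit sees the second coordinate of the next one there. -/
lemma Observable.mean_fst {B : ℝ} {h : ℝ × ℝ → ℂ} (hh : Observable B h) :
    Observable B (fun p => mean h p.1) := by
  have hd : ∀ y, HasDerivAt (mean h) (∫ v in (0 : ℝ)..1, fderiv ℝ h (v, y) (0, 1)) y :=
    hasDerivAt_integral_fst hh.contDiff hh.fderiv_le 1
  have hc' : Continuous (fderiv ℝ h) := hh.contDiff.continuous_fderiv one_ne_zero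
  have hC : ContDiff ℝ 1 (mean h) := by
    rw [contDiff_one_iff_deriv]
    refine ⟨fun y => (hd y).differentiableAt, ?_⟩
    rw [funext fun y => (hd y).deriv]
    refine intervalIntegral.continuous_parametric_intervalIntegral_of_continuous'
      (f := fun y v => fderiv ℝ h (v, y) (0, 1)) ?_ 0 1
    simp only [Function.uncurry_def]
    fun_prop
  have hB0 : 0 ≤ B := (norm_nonneg _).trans (hh.fderiv_le (0, 0))
  refine ⟨hC.comp contDiff_fst, fun p => ?_, fun p => hh.norm_mean_le_one p.1,
    fun x y => hh.mean_add_one x, fun x y => rfl⟩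
  have h1 : HasFDerivAt (fun p : ℝ × ℝ => mean h p.1) _ p :=
    (hd p.1).hasFDerivAt.comp p (hasFDerivAt_fst (p := p))
  rw [h1.fderiv]
  refine (ContinuousLinearMap.opNorm_comp_le _ _).trans ?_
  rw [ContinuousLinearMap.norm_toSpanSingleton]
  have h2 : ‖∫ v in (0 : ℝ)..1, fderiv ℝ h (v, p.1) (0, 1)‖ ≤ B := by
    refine norm_integral_le_of_abs_le (fun v => ?_) zero_le_one le_rfl
    refine (ContinuousLinearMap.le_opNorm _ _).trans ?_
    simpa using hh.fderiv_le (v, p.1)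
  have h3 := ContinuousLinearMap.norm_fst_le ℝ ℝ ℝ
  calc _ ≤ B * 1 := by gcongr
    _ = B := mul_one B

/-- Decorrelation on the torus, integrated over all horizontal circles. -/
lemma Decorrelating.norm_integral_mul_le {F : ℕ → ℝ → ℝ} {q : ℕ → ℝ × ℝ → ℂ} {ρ Q : ℕ → ℝ}
    {r κ B : ℝ} (H : Decorrelating (fun n => F (n + 1)) q ρ Q r κ B) {h : ℝ × ℝ → ℂ}
    (hh : Observable B h) (n : ℕ) :
    ‖∫ p, torusWeight q F n p *
      (descend h (comp F n p) - descend (fun p => mean h p.2) (comp F n p))‖ ≤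
      10 * B / r + 4 * κ := by
  have hcomp := (measurePreserving_comp H.measurable n).measurable
  have hmean : Measurable fun p : ℝ × ℝ => mean h p.2 :=
    (hh.continuous_mean.comp continuous_snd).measurable
  refine norm_integral_torus_le (integrable_of_norm_le (c := 1 * (1 + 1)) ?_ fun p => ?_)
    fun y => ?_
  · exact (measurable_torusWeight (fun i => (H.differentiable i).continuous.measurable)
      H.measurable n).mul
      (((measurable_descend hh.contDiff.continuous.measurable).comp hcomp).sub
        ((measurable_descend hmean).comp hcomp))
  · rw [norm_mul]
    exact mul_le_mul (norm_torusWeight_le_one H.norm_le_one _ _ _)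
      ((norm_sub_le _ _).trans (add_le_add (hh.norm_le_one _) (hh.norm_mean_le_one _)))
      (norm_nonneg _) zero_le_one
  · refine Eq.trans_le ?_ (norm_integral_weight_mul_le H.contDiff H.degree H.two_le H.nonneg
      H.le_quarter H.two_mul_le H.deriv_le H.deriv2_le H.four_mul_le H.differentiable H.fderiv_le
      H.norm_le_one H.eq_zero H.periodic_fst H.periodic_snd hh.contDiff hh.fderiv_le
      hh.norm_le_one hh.periodic_fst hh.periodic_snd y n)
    congr 1
    refine intervalIntegral.integral_congr fun s _ => ?_
    simp only [torusWeight, weight, comp_coe H.degree]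
    rw [descend_coe hh.periodic_fst hh.periodic_snd, descend_coe (fun x y => rfl)
      (fun x y => hh.mean_add_one y)]
    congr 1
    refine Finset.prod_congr rfl fun i _ => ?_
    rw [descend_coe (H.periodic_fst i) (H.periodic_snd i)]

lemma integral_descend {h : ℝ × ℝ → ℂ} (hh : Measurable h) {c : ℝ} (hc : ∀ p, ‖h p‖ ≤ c)
    (hx : ∀ x y, h (x + 1, y) = h (x, y)) (hy : ∀ x y, h (x, y + 1) = h (x, y)) :
    ∫ p, descend h p = ∫ y in (0 : ℝ)..1, ∫ x in (0 : ℝ)..1, h (x, y) := by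
  have e : ∫ p, descend h p = ∫ y, ∫ x, descend h (x, y) :=
    integral_prod_symm _ (integrable_of_norm_le (measurable_descend hh) fun p => hc _)
  rw [e, integral_circle]
  refine intervalIntegral.integral_congr fun y _ => ?_
  refine (integral_circle _).trans (intervalIntegral.integral_congr fun x _ => ?_)
  exact descend_coe hx hy x y

/-- If all the factors of two products are bounded by `1`, then the products differ at most by the
sum of the differences of the factors. -/
lemma norm_prod_sub_prod_le {ι : Type*} (s : Finset ι) {a b : ι → ℂ} (ha : ∀ i, ‖a i‖ ≤ 1)
    (hb : ∀ i, ‖b i‖ ≤ 1) : ‖∏ i ∈ s, a i - ∏ i ∈ s, b i‖ ≤ ∑ i ∈ s, ‖a i - b i‖ := by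
  classical
  induction s using Finset.induction_on with
  | empty => simp
  | insert j s hj ih =>
    rw [Finset.prod_insert hj, Finset.prod_insert hj, Finset.sum_insert hj]
    have hP : ‖∏ i ∈ s, b i‖ ≤ 1 := by
      rw [norm_prod]; exact Finset.prod_le_one (fun _ _ => norm_nonneg _) fun i _ => hb i
    calc _ = ‖(a j - b j) * ∏ i ∈ s, b i + a j * (∏ i ∈ s, a i - ∏ i ∈ s, b i)‖ := by
          congr 1; ring
      _ ≤ ‖a j - b j‖ * ‖∏ i ∈ s, b i‖ + ‖a j‖ * ‖∏ i ∈ s, a i - ∏ i ∈ s, b i‖ := by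
          refine (norm_add_le _ _).trans ?_
          rw [norm_mul, norm_mul]
      _ ≤ ‖a j - b j‖ * 1 + 1 * ‖∏ i ∈ s, a i - ∏ i ∈ s, b i‖ := by
          gcongr; exact ha j
      _ ≤ _ := by linarith

lemma norm_sub_pow_le_of_recursion {a : ℕ → ℂ} {z : ℂ} {δ : ℝ} (hz : ‖z‖ ≤ 1) (h0 : a 0 = 1)
    (h : ∀ n, ‖a (n + 1) - z * a n‖ ≤ δ) (n : ℕ) : ‖a n - z ^ n‖ ≤ n * δ := by
  induction n with
  | zero => simp [h0]
  | succ n ih =>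
    calc ‖a (n + 1) - z ^ (n + 1)‖ = ‖(a (n + 1) - z * a n) + z * (a n - z ^ n)‖ := by
          congr 1; ring
      _ ≤ ‖a (n + 1) - z * a n‖ + ‖z‖ * ‖a n - z ^ n‖ := by
          rw [← norm_mul]; exact norm_add_le _ _
      _ ≤ δ + 1 * (n * δ) := by gcongr; exact h n
      _ = _ := by push_cast; ring

lemma norm_integral_le_integral {G : Torus2 → ℂ} {D : Torus2 → ℝ} (hD : Integrable D)
    (h : ∀ p, ‖G p‖ ≤ D p) : ‖∫ p, G p‖ ≤ ∫ p, D p :=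
  norm_integral_le_of_norm_le hD (Eventually.of_forall h)

lemma integral_abs_cutoff_comp {F : ℕ → ℝ → ℝ} (hF : ∀ n, Measurable (F (n + 1))) {χ : ℝ → ℝ}
    (hχ : Measurable χ) (n : ℕ) :
    ∫ p, |descend (fun p => χ p.1) (comp F n p) - 1| =
      ∫ x : UnitAddCircle, |χ (AddCircle.equivIco (1 : ℝ) 0 x) - 1| := by
  have hm : Measurable fun x : UnitAddCircle => |χ (AddCircle.equivIco (1 : ℝ) 0 x) - 1| :=
    ((hχ.comp measurable_rep).sub_const 1).norm
  have h1 : MeasurePreserving (Prod.fst : Torus2 → UnitAddCircle) := measurePreserving_fst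
  have h2 := h1.comp (measurePreserving_comp hF n)
  rw [← h2.map_eq, integral_map h2.measurable.aemeasurable hm.aestronglyMeasurable]
  rfl

/-- Each step of the orbit multiplies the integral of the weight by the mean of the observable `e`,
up to a small error: decorrelation replaces `e` at the last step by its mean over the last
coordinate, which itself is a function of the coordinate before; as this function is close to `1`,
its correlation with the previous factor is negligible, and decorrelation applies once more. -/
lemma Decorrelating.norm_integral_succ_sub_le {F : ℕ → ℝ → ℝ} {χ : ℕ → ℝ → ℝ} {e : ℝ × ℝ → ℂ}
    {ρ Q : ℕ → ℝ} {r κ B b₁ b₂ P : ℝ}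
    (H : Decorrelating (fun n => F (n + 1)) (fun i p => χ i p.1 * e p) ρ Q r κ B)
    (he : Observable B e) (hχm : ∀ i, Measurable (χ i)) (hχ0 : ∀ i x, 0 ≤ χ i x)
    (hχ1 : ∀ i x, χ i x ≤ 1)
    (hP : ∀ i, ∫ x : UnitAddCircle, |χ i (AddCircle.equivIco (1 : ℝ) 0 x) - 1| ≤ P)
    (hb₁ : ∀ p, ‖e p - 1‖ ≤ b₁) (hb₂ : ∀ y, ‖mean e y - 1‖ ≤ b₂) (n : ℕ) :
    ‖(∫ p, torusWeight (fun i p => χ i p.1 * e p) F (n + 1) p) -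
      (∫ p, descend e p) * ∫ p, torusWeight (fun i p => χ i p.1 * e p) F n p‖ ≤
      P + 2 * (10 * B / r + 4 * κ) + 2 * b₂ * (b₁ + P) := by
  set q : ℕ → ℝ × ℝ → ℂ := fun i p => χ i p.1 * e p with hq_def
  set A := torusWeight q F with hA_def
  have hF := H.measurable
  have hAm : ∀ n, Measurable (A n) := measurable_torusWeight
    (fun i => (H.differentiable i).continuous.measurable) hF
  have hA1 : ∀ n p, ‖A n p‖ ≤ 1 := norm_torusWeight_le_one H.norm_le_one F
  have hcm : ∀ n, Measurable (comp F n) := fun n => (measurePreserving_comp hF n).measurable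
  have hB0 : 0 ≤ B := (norm_nonneg _).trans (he.fderiv_le (0, 0))
  have hr0 : 0 < r := by linarith [H.two_le]
  have hδ0 : 0 ≤ 10 * B / r + 4 * κ := by have := H.nonneg; positivity
  have hb₁0 : 0 ≤ b₁ := (norm_nonneg _).trans (hb₁ 0)
  have hb₂0 : 0 ≤ b₂ := (norm_nonneg _).trans (hb₂ 0)
  have hP0 : 0 ≤ P := (integral_nonneg fun _ => abs_nonneg _).trans (hP 0)
  have hz : (∫ p, descend e p) = ∫ y in (0 : ℝ)..1, mean e y :=
    integral_descend he.contDiff.continuous.measurable he.norm_le_one he.periodic_fst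
      he.periodic_snd
  -- the cutoff, read on the torus at time `n`
  set c : ℕ → Torus2 → ℝ := fun n p => descend (fun p => χ n p.1) (comp F n p) with hc_def
  have hcutm : ∀ n, Measurable (c n) := fun n =>
    (measurable_descend ((hχm n).comp measurable_fst)).comp (hcm n)
  have hcut1 : ∀ n p, |c n p - 1| ≤ 1 := fun n p => by
    have h0 : 0 ≤ c n p := hχ0 n _
    have h1 : c n p ≤ 1 := hχ1 n _
    rw [abs_le]; constructor <;> linarith
  have hcutint : ∀ n, Integrable fun p => |c n p - 1| := fun n =>
    Integrable.of_bound (((hcutm n).sub_const 1).norm).aestronglyMeasurable 1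
      (Eventually.of_forall fun p => by rw [Real.norm_eq_abs, abs_abs]; exact hcut1 n p)
  have hcutP : ∀ n, ∫ p, |c n p - 1| ≤ P := fun n =>
    (integral_abs_cutoff_comp hF (hχm n) n).trans_le (hP n)
  set E : ℕ → Torus2 → ℂ := fun n p => descend e (comp F n p) with hE_def
  have hEm : ∀ n, Measurable (E n) := fun n =>
    (measurable_descend he.contDiff.continuous.measurable).comp (hcm n)
  have hE1 : ∀ n p, ‖E n p‖ ≤ 1 := fun n p => he.norm_le_one _
  have hAsucc : ∀ n p, A (n + 1) p = A n p * (c n p * E n p) := fun n p =>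
    Finset.prod_range_succ _ _
  have hAint : ∀ n, Integrable (A n) := fun n => integrable_of_norm_le (hAm n) (hA1 n)
  -- removing the last cutoff
  have hcutoff : ∀ n, ‖∫ p, A n p * ((c n p - 1 : ℝ) * E n p)‖ ≤ P := fun n => by
    refine (norm_integral_le_integral (hcutint n) fun p => ?_).trans (hcutP n)
    rw [norm_mul, norm_mul, Complex.norm_real, Real.norm_eq_abs]
    calc _ ≤ 1 * (|c n p - 1| * 1) := by
          gcongr
          · exact hA1 n p
          · exact hE1 n p
      _ = _ := by ring
  have hcutoff_int : ∀ n, Integrable fun p => A n p * ((c n p - 1 : ℝ) * E n p) := fun n => by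
    refine integrable_of_norm_le (c := 1 * (1 * 1)) ?_ fun p => ?_
    · exact (hAm n).mul ((Complex.measurable_ofReal.comp ((hcutm n).sub_const 1)).mul (hEm n))
    · rw [norm_mul, norm_mul, Complex.norm_real, Real.norm_eq_abs]
      gcongr
      · exact hA1 n p
      · exact hcut1 n p
      · exact hE1 n p
  cases n with
  | zero =>
    have e1 : (∫ p, A 1 p) = (∫ p, A 0 p * ((c 0 p - 1 : ℝ) * E 0 p)) + ∫ p, E 0 p := by
      rw [← integral_add (hcutoff_int 0) (integrable_of_norm_le (hEm 0) (hE1 0))]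
      refine integral_congr_ae (Eventually.of_forall fun p => ?_)
      simp only [hAsucc]
      have : A 0 p = 1 := by simp [hA_def, torusWeight]
      rw [this]
      push_cast
      ring
    have e2 : (∫ p, A 0 p) = 1 := by simp [hA_def, torusWeight]
    have e3 : (∫ p, E 0 p) = ∫ p, descend e p := rfl
    rw [e2, zero_add, e1, e3, mul_one, add_sub_cancel_right]
    have := hcutoff 0
    have : 0 ≤ 2 * b₂ * (b₁ + P) := by positivity
    linarith
  | succ n =>
    set z := ∫ p, descend e p
    have hmm : Measurable fun p : ℝ × ℝ => mean e p.2 :=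
      (he.continuous_mean.comp continuous_snd).measurable
    have hz1 : ‖z - 1‖ ≤ b₂ := by
      have : z - 1 = ∫ y in (0 : ℝ)..1, (mean e y - 1) := by
        rw [intervalIntegral.integral_sub (he.continuous_mean.intervalIntegrable _ _)
          intervalIntegrable_const, hz]
        simp
      rw [this]
      exact norm_integral_le_of_abs_le hb₂ zero_le_one le_rfl
    have hmeanz : ∀ y, ‖mean e y - z‖ ≤ 2 * b₂ := fun y => by
      calc ‖mean e y - z‖ = ‖(mean e y - 1) - (z - 1)‖ := by congr 1; ring
        _ ≤ b₂ + b₂ := (norm_sub_le _ _).trans (add_le_add (hb₂ y) hz1)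
        _ = _ := by ring
    set S : Torus2 → ℂ := fun p => descend (fun p => mean e p.2) (comp F (n + 1) p) with hS_def
    have hSm : Measurable S := (measurable_descend hmm).comp (hcm (n + 1))
    have hS1 : ∀ p, ‖S p‖ ≤ 1 := fun p => he.norm_mean_le_one _
    have hSz : ∀ p, ‖S p - z‖ ≤ 2 * b₂ := fun p => hmeanz _
    have hSfst : ∀ p, S p = descend (fun p => mean e p.1) (comp F n p) := fun p => rfl
    have i2 : ‖∫ p, A (n + 1) p * (E (n + 1) p - S p)‖ ≤ 10 * B / r + 4 * κ :=
      H.norm_integral_mul_le he (n + 1)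
    have i4 : ‖∫ p, A n p * (S p - z)‖ ≤ 10 * B / r + 4 * κ := by
      refine Eq.trans_le ?_ (H.norm_integral_mul_le he.mean_fst n)
      congr 2 with p
      rw [hSfst, hz]
      congr 2
    have hdiff : ∀ p, ‖A (n + 1) p - A n p‖ ≤ |c n p - 1| + b₁ := fun p => by
      have : A (n + 1) p - A n p = A n p * ((c n p - 1 : ℝ) * E n p + (E n p - 1)) := by
        rw [hAsucc]; push_cast; ring
      rw [this, norm_mul]
      calc _ ≤ 1 * (|c n p - 1| * 1 + b₁) := by
            gcongr
            · exact hA1 n p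
            · refine (norm_add_le _ _).trans (add_le_add ?_ (hb₁ _))
              rw [norm_mul, Complex.norm_real, Real.norm_eq_abs]
              gcongr
              exact hE1 n p
        _ = _ := by ring
    have i3 : ‖∫ p, (A (n + 1) p - A n p) * (S p - z)‖ ≤ 2 * b₂ * (b₁ + P) := by
      have hint : Integrable fun p => 2 * b₂ * (|c n p - 1| + b₁) :=
        ((hcutint n).add (integrable_const b₁)).const_mul _
      refine (norm_integral_le_integral hint fun p => ?_).trans ?_
      · rw [norm_mul, mul_comm]
        exact mul_le_mul (hSz p) (hdiff p) (norm_nonneg _) (by positivity)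
      · rw [integral_const_mul, integral_add (hcutint n) (integrable_const b₁)]
        have := hcutP n
        simp only [integral_const, probReal_univ, one_smul]
        rw [add_comm b₁]
        gcongr
    have hint2 : Integrable fun p => A (n + 1) p * (E (n + 1) p - S p) := by
      refine integrable_of_norm_le (c := 1 * (1 + 1)) ((hAm _).mul ((hEm _).sub hSm)) fun p => ?_
      rw [norm_mul]
      exact mul_le_mul (hA1 _ p) ((norm_sub_le _ _).trans (add_le_add (hE1 _ p) (hS1 p)))
        (norm_nonneg _) zero_le_one
    have hint4 : ∀ n, Integrable fun p => A n p * (S p - z) := fun n => by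
      refine integrable_of_norm_le (c := 1 * (2 * b₂)) ((hAm _).mul (hSm.sub_const z)) fun p => ?_
      rw [norm_mul]
      exact mul_le_mul (hA1 _ p) (hSz p) (norm_nonneg _) zero_le_one
    have hint3 : Integrable fun p => (A (n + 1) p - A n p) * (S p - z) := by
      simp only [sub_mul (A _ _)]
      exact (hint4 _).sub (hint4 _)
    have key : (∫ p, A (n + 2) p) - z * ∫ p, A (n + 1) p =
        (∫ p, A (n + 1) p * ((c (n + 1) p - 1 : ℝ) * E (n + 1) p)) +
        (∫ p, A (n + 1) p * (E (n + 1) p - S p)) + (∫ p, (A (n + 1) p - A n p) * (S p - z)) +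
        ∫ p, A n p * (S p - z) := by
      rw [← integral_const_mul, ← integral_sub (hAint _) ((hAint _).const_mul z),
        ← integral_add (hcutoff_int _) hint2, ← integral_add ?_ hint3, ← integral_add ?_ (hint4 n)]
      · refine integral_congr_ae (Eventually.of_forall fun p => ?_)
        simp only
        rw [hAsucc (n + 1) p]
        push_cast
        ring
      · exact ((hcutoff_int _).add hint2).add hint3
      · exact (hcutoff_int _).add hint2
    rw [key]
    have i1 := hcutoff (n + 1)
    refine (norm_add_le _ _).trans ?_
    have := norm_add₃_le (a := ∫ p, A (n + 1) p * ((c (n + 1) p - 1 : ℝ) * E (n + 1) p))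
      (b := ∫ p, A (n + 1) p * (E (n + 1) p - S p))
      (c := ∫ p, (A (n + 1) p - A n p) * (S p - z))
    linarith

/-- The integral of the product of an observable along an orbit is close to a power of its mean. -/
lemma Decorrelating.norm_integral_prod_sub_pow_le {F : ℕ → ℝ → ℝ} {χ : ℕ → ℝ → ℝ} {e : ℝ × ℝ → ℂ}
    {ρ Q : ℕ → ℝ} {r κ B b₁ b₂ P : ℝ}
    (H : Decorrelating (fun n => F (n + 1)) (fun i p => χ i p.1 * e p) ρ Q r κ B)
    (he : Observable B e) (hχm : ∀ i, Measurable (χ i)) (hχ0 : ∀ i x, 0 ≤ χ i x)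
    (hχ1 : ∀ i x, χ i x ≤ 1)
    (hP : ∀ i, ∫ x : UnitAddCircle, |χ i (AddCircle.equivIco (1 : ℝ) 0 x) - 1| ≤ P)
    (hb₁ : ∀ p, ‖e p - 1‖ ≤ b₁) (hb₂ : ∀ y, ‖mean e y - 1‖ ≤ b₂) (n : ℕ) :
    ‖(∫ p, ∏ i ∈ Finset.range n, descend e (comp F i p)) - (∫ p, descend e p) ^ n‖ ≤
      n * (2 * P + 2 * (10 * B / r + 4 * κ) + 2 * b₂ * (b₁ + P)) := by
  set q : ℕ → ℝ × ℝ → ℂ := fun i p => χ i p.1 * e p with hq_def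
  have hF := H.measurable
  have hz : ‖∫ p, descend e p‖ ≤ 1 := by
    refine (norm_integral_le_of_norm_le_const (Eventually.of_forall fun p =>
      he.norm_le_one _)).trans ?_
    simp
  have h1 := norm_sub_pow_le_of_recursion (a := fun n => ∫ p, torusWeight q F n p) hz
    (by simp [torusWeight])
    (fun n => H.norm_integral_succ_sub_le he hχm hχ0 hχ1 hP hb₁ hb₂ n) n
  have hem := measurable_descend he.contDiff.continuous.measurable
  have hcm : ∀ n, Measurable (comp F n) := fun n => (measurePreserving_comp hF n).measurable
  have hprodm : Measurable fun p => ∏ i ∈ Finset.range n, descend e (comp F i p) :=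
    Finset.measurable_fun_prod _ fun i _ => hem.comp (hcm i)
  have hcutint : ∀ n, Integrable fun p => |descend (fun p => χ n p.1) (comp F n p) - 1| :=
    fun n => by
      have hm : Measurable fun p => descend (fun p => χ n p.1) (comp F n p) :=
        (measurable_descend ((hχm n).comp measurable_fst)).comp (hcm n)
      refine Integrable.of_bound ((hm.sub_const 1).norm).aestronglyMeasurable 1
        (Eventually.of_forall fun p => ?_)
      rw [Real.norm_eq_abs, abs_abs, abs_le]
      have h0 : 0 ≤ descend (fun p => χ n p.1) (comp F n p) := hχ0 n _
      have h1 : descend (fun p => χ n p.1) (comp F n p) ≤ 1 := hχ1 n _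
      constructor <;> linarith
  have h2 : ‖(∫ p, ∏ i ∈ Finset.range n, descend e (comp F i p)) -
      ∫ p, torusWeight q F n p‖ ≤ n * P := by
    rw [← integral_sub (integrable_of_norm_le (c := 1) hprodm fun p => ?_)
      (integrable_of_norm_le (measurable_torusWeight
        (fun i => (H.differentiable i).continuous.measurable) hF n)
        (norm_torusWeight_le_one H.norm_le_one F n))]
    · refine (norm_integral_le_integral (integrable_finsetSum (Finset.range n)
        fun i _ => hcutint i) fun p => ?_).trans ?_
      · refine (norm_prod_sub_prod_le _ (fun i => he.norm_le_one _)
          (fun i => H.norm_le_one i _)).trans (Finset.sum_le_sum fun i _ => ?_)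
        change ‖descend e (comp F i p) - descend (q i) (comp F i p)‖ ≤ _
        have : descend e (comp F i p) - descend (q i) (comp F i p) =
            -((descend (fun p => χ i p.1) (comp F i p) - 1 : ℝ) * descend e (comp F i p)) := by
          simp only [hq_def, descend]; push_cast; ring
        rw [this, norm_neg, norm_mul, Complex.norm_real, Real.norm_eq_abs]
        exact mul_le_of_le_one_right (abs_nonneg _) (he.norm_le_one _)
      · rw [integral_finsetSum _ fun i _ => hcutint i]
        refine (Finset.sum_le_card_nsmul _ _ P fun i _ =>
          (integral_abs_cutoff_comp hF (hχm i) i).trans_le (hP i)).trans_eq ?_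
        simp
    · rw [norm_prod]
      exact Finset.prod_le_one (fun _ _ => norm_nonneg _) fun i _ => he.norm_le_one _
  refine (norm_sub_le_norm_sub_add_norm_sub _ (∫ p, torusWeight q F n p) _).trans ?_
  refine (add_le_add h2 h1).trans_eq ?_
  ring

/-! ### Cutoffs near the critical sets -/

/-- A smooth cutoff vanishing on `[-1, 1]` and equal to `1` outside `[-2, 2]`. -/
lemma exists_cutoff : ∃ (τ : ℝ → ℝ) (C : ℝ), 0 < C ∧ ContDiff ℝ 1 τ ∧ (∀ z, |deriv τ z| ≤ C) ∧
    (∀ z, 0 ≤ τ z) ∧ (∀ z, τ z ≤ 1) ∧ (∀ z, |z| ≤ 1 → τ z = 0) ∧ ∀ z, 2 ≤ |z| → τ z = 1 := by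
  set b : ContDiffBump (0 : ℝ) := ⟨1, 2, by norm_num, by norm_num⟩
  have hb : ContDiff ℝ 1 b := b.contDiff
  obtain ⟨C, hC⟩ := (hb.continuous_deriv_one).bounded_above_of_compact_support
    b.hasCompactSupport.deriv
  refine ⟨fun z => 1 - b z, C + 1, ?_, contDiff_const.sub hb, fun z => ?_, fun z => ?_, fun z => ?_,
    fun z hz => ?_, fun z hz => ?_⟩
  · have := (norm_nonneg _).trans (hC 0)
    linarith
  · rw [deriv_const_sub, abs_neg]
    have := hC z
    rw [Real.norm_eq_abs] at this
    linarith
  · linarith [b.le_one (x := z)]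
  · linarith [b.nonneg (x := z)]
  · have := b.one_of_mem_closedBall (x := z) (by simpa using! hz)
    simp only [this, sub_self]
  · have := b.zero_of_le_dist (x := z) (by simpa using! hz)
    simp only [this, sub_zero]

namespace Admissible

variable {M₀ : ℕ} {K₀ K₁ ℓ : ℝ} {f : ℝ → ℝ}

lemma deriv_le (hf : Admissible M₀ K₀ K₁ ℓ f) (x : ℝ) : |deriv f x| ≤ K₀ * ℓ :=
  (le_add_of_nonneg_right (abs_nonneg _)).trans (hf.norm_le x x)

lemma deriv2_le (hf : Admissible M₀ K₀ K₁ ℓ f) (x : ℝ) : |deriv (deriv f) x| ≤ K₀ * ℓ :=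
  (le_add_of_nonneg_left (abs_nonneg _)).trans (hf.norm_le x x)

/-- The set of points close to the critical set is covered by at most `M₀` short arcs. -/
lemma volume_thickening_le (hf : Admissible M₀ K₀ K₁ ℓ f) {δ : ℝ} (hδ : 0 ≤ δ) :
    (volume : Measure UnitAddCircle).real {x | Metric.infDist x (critSet f) < δ} ≤
      M₀ * (2 * δ) := by
  have hsub : {x | Metric.infDist x (critSet f) < δ} ⊆
      ⋃ c ∈ hf.crit_finite.toFinset, Metric.closedBall c δ := by
    intro x hx
    obtain ⟨c, hc, hxc⟩ := (Metric.infDist_lt_iff hf.crit_nonempty).1 hx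
    exact Set.mem_biUnion (hf.crit_finite.mem_toFinset.2 hc) hxc.le
  refine (measureReal_mono hsub (measure_ne_top _ _)).trans
    ((measureReal_biUnion_finset_le _ _).trans ?_)
  refine (Finset.sum_le_card_nsmul _ _ (2 * δ) fun c _ => ?_).trans ?_
  · rw [measureReal_def, AddCircle.volume_closedBall]
    refine ENNReal.toReal_le_of_le_ofReal (by positivity) (ENNReal.ofReal_le_ofReal ?_)
    exact min_le_right _ _
  · rw [nsmul_eq_mul, ← Set.ncard_eq_toFinset_card _ hf.crit_finite]
    have : ((critSet f).ncard : ℝ) ≤ M₀ := by exact_mod_cast hf.crit_card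
    gcongr

lemma deriv_add_one (hf : Admissible M₀ K₀ K₁ ℓ f) (x : ℝ) : deriv f (x + 1) = deriv f x := by
  obtain ⟨d, hd⟩ := hf.degree
  exact StdMap.deriv_add_one hd x

/-- Where the cutoff of the derivative at scale `ℓ * η` differs from `1`, the derivative is below
`2 * ℓ * η`, which happens only at distance less than `2 * K₁ * η` from the critical set. -/
lemma integral_cutoff_le (hf : Admissible M₀ K₀ K₁ ℓ f) (hK₁ : 0 < K₁) (hℓ : 0 < ℓ) {η : ℝ}
    (hη : 0 < η) {τ : ℝ → ℝ} (h0 : ∀ z, 0 ≤ τ z) (h1 : ∀ z, τ z ≤ 1)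
    (h2 : ∀ z, 2 ≤ |z| → τ z = 1) :
    ∫ x : UnitAddCircle, |τ (deriv f (AddCircle.equivIco (1 : ℝ) 0 x) / (ℓ * η)) - 1| ≤
      M₀ * (4 * K₁ * η) := by
  set U : Set UnitAddCircle := {x | Metric.infDist x (critSet f) < 2 * K₁ * η}
  have hU : MeasurableSet U := measurableSet_lt (Metric.continuous_infDist_pt _).measurable
    measurable_const
  have hle : ∀ x : UnitAddCircle,
      |τ (deriv f (AddCircle.equivIco (1 : ℝ) 0 x) / (ℓ * η)) - 1| ≤ U.indicator 1 x := by
    intro x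
    by_cases hx : x ∈ U
    · rw [Set.indicator_of_mem hx, Pi.one_apply, abs_le]
      have := h0 (deriv f (AddCircle.equivIco (1 : ℝ) 0 x) / (ℓ * η))
      have := h1 (deriv f (AddCircle.equivIco (1 : ℝ) 0 x) / (ℓ * η))
      constructor <;> linarith
    · rw [Set.indicator_of_notMem hx]
      have hx' : 2 * K₁ * η ≤ Metric.infDist x (critSet f) := not_lt.1 hx
      have h3 := hf.le_abs_deriv (AddCircle.equivIco (1 : ℝ) 0 x)
      rw [AddCircle.coe_equivIco] at h3
      have h4 : ℓ * K₁⁻¹ * (2 * K₁ * η) ≤ ℓ * K₁⁻¹ * Metric.infDist x (critSet f) := by gcongr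
      have h5 : ℓ * K₁⁻¹ * (2 * K₁ * η) = 2 * (ℓ * η) := by field_simp
      rw [h2, sub_self, abs_zero]
      rw [abs_div, abs_of_pos (mul_pos hℓ hη), le_div_iff₀ (mul_pos hℓ hη)]
      linarith
  calc _ ≤ ∫ x : UnitAddCircle, U.indicator (1 : UnitAddCircle → ℝ) x :=
        integral_mono_of_nonneg (Eventually.of_forall fun _ => abs_nonneg _)
          ((integrable_const (1 : ℝ)).indicator hU) (Eventually.of_forall hle)
    _ = volume.real U := integral_indicator_one hU
    _ ≤ M₀ * (2 * (2 * K₁ * η)) := hf.volume_thickening_le (by positivity)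
    _ = _ := by ring

end Admissible

/-! ### Characteristic functions of Birkhoff sums -/

lemma norm_cexp_sub_cexp_le (a b : ℝ) :
    ‖Complex.exp (a * Complex.I) - Complex.exp (b * Complex.I)‖ ≤ |a - b| := by
  have h1 : Complex.exp (a * Complex.I) - Complex.exp (b * Complex.I) =
      Complex.exp (b * Complex.I) * (Complex.exp (Complex.I * ((a - b : ℝ) : ℂ)) - 1) := by
    rw [mul_sub, ← Complex.exp_add, mul_one]
    congr 2
    push_cast
    ring
  rw [h1, norm_mul, Complex.norm_exp_ofReal_mul_I, one_mul, ← Real.norm_eq_abs]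
  exact Real.norm_exp_I_mul_ofReal_sub_one_le

lemma norm_cexp_sub_one_le (a : ℝ) : ‖Complex.exp (a * Complex.I) - 1‖ ≤ |a| := by
  simpa using norm_cexp_sub_cexp_le a 0

lemma norm_cexp_sub_one_sub_le (a : ℝ) :
    ‖Complex.exp (a * Complex.I) - 1 - a * Complex.I‖ ≤ 3 * a ^ 2 := by
  have hn : ‖(a : ℂ) * Complex.I‖ = |a| := by simp
  rw [← sq_abs]
  rcases le_or_gt |a| 1 with h | h
  · have := Complex.norm_exp_sub_one_sub_id_le (x := a * Complex.I) (by rw [hn]; exact h)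
    rw [hn] at this
    nlinarith [sq_nonneg |a|]
  · refine (norm_sub_le _ _).trans ?_
    have := norm_cexp_sub_one_le a
    rw [hn]
    nlinarith

lemma observable_cexp {M : ℝ × ℝ → ℝ} (hM : ContDiff ℝ 1 M) {B θ : ℝ} (hθ : |θ| ≤ 1)
    (hB : ∀ p, ‖fderiv ℝ M p‖ ≤ B) (hx : ∀ x y, M (x + 1, y) = M (x, y))
    (hy : ∀ x y, M (x, y + 1) = M (x, y)) :
    Observable B (fun p => Complex.exp ((θ * M p : ℝ) * Complex.I)) := by
  refine ⟨?_, fun p => ?_, fun p => (Complex.norm_exp_ofReal_mul_I _).le, fun x y => by rw [hx],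
    fun x y => by rw [hy]⟩
  · have h1 : ContDiff ℝ 1 fun p => ((θ * M p : ℝ) : ℂ) :=
      Complex.ofRealCLM.contDiff.comp (contDiff_const.mul hM)
    exact (h1.mul contDiff_const).cexp
  · have h1 : HasDerivAt (fun a : ℝ => Complex.exp (a * Complex.I))
        (Complex.exp ((θ * M p : ℝ) * Complex.I) * Complex.I) (θ * M p) := by
      have := ((hasDerivAt_id ((θ * M p : ℝ) : ℂ)).mul_const Complex.I).cexp.comp_ofReal
      simpa using this
    have h2 : HasFDerivAt (fun p => θ * M p) (θ • fderiv ℝ M p) p :=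
      (hM.differentiable one_ne_zero p).hasFDerivAt.const_mul θ
    have h3 := (HasFDerivAt.comp (g := fun a : ℝ => Complex.exp (a * Complex.I)) p
      h1.hasFDerivAt h2).fderiv
    simp only [Function.comp_def] at h3
    rw [h3]
    refine (ContinuousLinearMap.opNorm_comp_le _ _).trans ?_
    rw [ContinuousLinearMap.norm_toSpanSingleton, norm_mul, Complex.norm_exp_ofReal_mul_I,
      Complex.norm_I, norm_smul, Real.norm_eq_abs, one_mul, one_mul]
    have := hB p
    calc |θ| * ‖fderiv ℝ M p‖ ≤ 1 * B := by gcongr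
      _ = B := one_mul B

lemma norm_fderiv_cutoff_mul_le {χ : ℝ → ℝ} (hχ : Differentiable ℝ χ) {B₁ B₂ : ℝ}
    (hχB : ∀ x, |deriv χ x| ≤ B₁) (hχ0 : ∀ x, 0 ≤ χ x) (hχ1 : ∀ x, χ x ≤ 1) {e : ℝ × ℝ → ℂ}
    (he : Observable B₂ e) (p : ℝ × ℝ) :
    Differentiable ℝ (fun p : ℝ × ℝ => (χ p.1 : ℂ) * e p) ∧
      ‖fderiv ℝ (fun p : ℝ × ℝ => (χ p.1 : ℂ) * e p) p‖ ≤ B₁ + B₂ := by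
  have h1 : ∀ p : ℝ × ℝ, HasFDerivAt (fun p : ℝ × ℝ => (χ p.1 : ℂ))
      ((ContinuousLinearMap.toSpanSingleton ℝ ((deriv χ p.1 : ℝ) : ℂ)).comp
        (ContinuousLinearMap.fst ℝ ℝ ℝ)) p :=
    fun p => ((hχ p.1).hasDerivAt.ofReal_comp).hasFDerivAt.comp p hasFDerivAt_fst
  have h2 : ∀ p, HasFDerivAt e (fderiv ℝ e p) p :=
    fun p => (he.contDiff.differentiable one_ne_zero p).hasFDerivAt
  refine ⟨fun p => ((h1 p).mul (h2 p)).differentiableAt, ?_⟩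
  have h3 : HasFDerivAt (fun p : ℝ × ℝ => (χ p.1 : ℂ) * e p) _ p := (h1 p).mul (h2 p)
  rw [h3.fderiv, add_comm B₁]
  refine (norm_add_le _ _).trans (add_le_add ?_ ?_)
  · rw [norm_smul, Complex.norm_real, Real.norm_eq_abs, abs_of_nonneg (hχ0 _)]
    exact (mul_le_of_le_one_left (norm_nonneg _) (hχ1 _)).trans (he.fderiv_le p)
  · rw [norm_smul]
    refine (mul_le_of_le_one_left (norm_nonneg _) (he.norm_le_one p)).trans ?_
    refine (ContinuousLinearMap.opNorm_comp_le _ _).trans ?_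
    rw [ContinuousLinearMap.norm_toSpanSingleton, Complex.norm_real, Real.norm_eq_abs]
    exact (mul_le_of_le_one_right (abs_nonneg _)
      (ContinuousLinearMap.norm_fst_le ℝ ℝ ℝ)).trans (hχB _)

/-- Along maps with large coefficients, cutoffs at scale `η` around the critical sets make an
observable decorrelate. -/
lemma decorrelating_of_admissible {M₀ : ℕ} {K₀ K₁ Λ η : ℝ} (hK₀ : 0 < K₀) {g : ℕ → ℝ → ℝ}
    {ℓ : ℕ → ℝ} (hℓ : ∀ n, Λ ≤ ℓ n) (hg : ∀ n, Admissible M₀ K₀ K₁ (ℓ n) (g n)) (hη : 0 < η)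
    (hη1 : η ≤ 1) (hΛ : 4 ≤ Λ * η ^ 2) (hΛ' : 16 * K₀ ≤ Λ * η ^ 2) {τ : ℝ → ℝ} {Cτ : ℝ}
    (hτ : ContDiff ℝ 1 τ) (hτ' : ∀ z, |deriv τ z| ≤ Cτ) (h0 : ∀ z, 0 ≤ τ z) (h1 : ∀ z, τ z ≤ 1)
    (hz : ∀ z, |z| ≤ 1 → τ z = 0) {e : ℝ × ℝ → ℂ} {B : ℝ} (he : Observable B e) :
    Decorrelating g (fun i p => (τ (deriv (g i) p.1 / (ℓ i * η)) : ℂ) * e p)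
      (fun i => ℓ i * η) (fun i => K₀ * ℓ i) (Λ * η / 2) (4 * K₀ / (Λ * η ^ 2))
      (Cτ * K₀ / η + B) := by
  have hη2 : 0 < η ^ 2 := by positivity
  have hΛ0 : 0 < Λ := by
    by_contra h
    have : Λ * η ^ 2 ≤ 0 := mul_nonpos_of_nonpos_of_nonneg (not_lt.1 h) hη2.le
    linarith
  have hℓ0 : ∀ n, 0 < ℓ n := fun n => hΛ0.trans_le (hℓ n)
  have hΛη : Λ * η ^ 2 ≤ Λ * η := by
    have : η ^ 2 ≤ η := by nlinarith
    gcongr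
  have hg2 : ∀ n, ContDiff ℝ 2 (g n) := fun n => (hg n).contDiff.of_le (by norm_num)
  have hg' : ∀ n, ContDiff ℝ 1 (deriv (g n)) := fun n => (contDiff_succ_iff_deriv.1 (hg2 n)).2.2
  have hχd : ∀ i x, HasDerivAt (fun x => τ (deriv (g i) x / (ℓ i * η)))
      (deriv τ (deriv (g i) x / (ℓ i * η)) * (deriv (deriv (g i)) x / (ℓ i * η))) x := fun i x =>
    (hτ.differentiable one_ne_zero _).hasDerivAt.comp x
      (((hg' i).differentiable one_ne_zero x).hasDerivAt.div_const _)
  have hCτ : 0 ≤ Cτ := (abs_nonneg _).trans (hτ' 0)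
  have hχB : ∀ i x, |deriv (fun x => τ (deriv (g i) x / (ℓ i * η))) x| ≤ Cτ * K₀ / η := by
    intro i x
    have hi := hℓ0 i
    rw [(hχd i x).deriv, abs_mul, abs_div, abs_of_pos (mul_pos hi hη)]
    have := (hg i).deriv2_le x
    have := hτ' (deriv (g i) x / (ℓ i * η))
    calc _ ≤ Cτ * (K₀ * ℓ i / (ℓ i * η)) := by gcongr
      _ = _ := by field_simp
  have hfd := fun i => norm_fderiv_cutoff_mul_le (fun x => (hχd i x).differentiableAt) (hχB i)
    (fun x => h0 _) (fun x => h1 _) he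
  refine
    { contDiff := hg2
      degree := fun n => (hg n).degree
      two_le := by linarith
      nonneg := by positivity
      le_quarter := by rw [div_le_iff₀ (by positivity)]; linarith
      two_mul_le := fun i => by
        have := hℓ i
        have : Λ * η ≤ ℓ i * η := by gcongr
        linarith
      deriv_le := fun i => (hg i).deriv_le
      deriv2_le := fun i => (hg i).deriv2_le
      four_mul_le := fun i => ?_
      differentiable := fun i => (hfd i 0).1
      fderiv_le := fun i p => (hfd i p).2
      norm_le_one := fun i p => ?_
      eq_zero := fun i p hp => ?_
      periodic_fst := fun i x y => ?_
      periodic_snd := fun i x y => ?_ }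
  · have hi := hℓ0 i
    have h3 : 4 * K₀ / (Λ * η ^ 2) * (ℓ i * η) ^ 2 = 4 * (K₀ * ℓ i) * (ℓ i / Λ) := by
      field_simp
    rw [h3]
    exact le_mul_of_one_le_right (by positivity) ((one_le_div hΛ0).2 (hℓ i))
  · rw [norm_mul, Complex.norm_real, Real.norm_eq_abs, abs_of_nonneg (h0 _)]
    exact mul_le_one₀ (h1 _) (norm_nonneg _) (he.norm_le_one p)
  · have hi := mul_pos (hℓ0 i) hη
    rw [hz, Complex.ofReal_zero, zero_mul]
    rw [abs_div, abs_of_pos hi, div_le_one hi]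
    exact hp.le
  · simp only [(hg i).deriv_add_one, he.periodic_fst]
  · simp only [he.periodic_snd]

/-- Collecting the errors of mollification and decorrelation: `t = |θ|`, `T = η ^ α` and
`W = 1 / (Λ * η ^ 2)`. The terms of order `t ^ 2` come multiplied by `t` or by the measure `η` of
the cutoff. -/
lemma error_le_mul_sum {a b K₀ K D t T η W : ℝ} (hK₀ : 0 ≤ K₀) (ha : 0 ≤ a) (hb : 0 ≤ b)
    (hK : 0 ≤ K) (hD : 0 ≤ D) (ht : 0 ≤ t) (ht1 : t ≤ 1) (hT : 0 ≤ T) (hT1 : T ≤ 1) (hη : 0 ≤ η)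
    (hηT : η ≤ T) (hW : 0 ≤ W) :
    K * T + (2 * (4 * b * η) + 2 * (20 * a * W + 4 * (4 * K₀ * W)) +
        2 * (t * (K * T) + 3 * (t ^ 2 * D ^ 2)) * (t * D + 4 * b * η) + K * T) ≤
      (4 + 16 * K₀ + (8 * b + 2 * (20 * a + 16 * K₀) + 2 * (K * D) + 6 * D ^ 3 +
        8 * (K + 3 * D ^ 2) * b + 2 * K)) * (t ^ 3 + T + W) := by
  set S := t ^ 3 + T + W with hS
  have ht3 : 0 ≤ t ^ 3 := by positivity
  have s1 : t ^ 3 ≤ S := by linarith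
  have s2 : T ≤ S := by linarith
  have s3 : W ≤ S := by linarith
  have s4 : η ≤ S := hηT.trans s2
  have hS0 : 0 ≤ S := ht3.trans s1
  have ht2 : t ^ 2 ≤ 1 := pow_le_one₀ ht ht1
  have q1 : b * η ≤ b * S := by gcongr
  have q2 : (t * (K * T) + 3 * (t ^ 2 * D ^ 2)) * (t * D) ≤ (K * D + 3 * D ^ 3) * S := by
    calc _ = t ^ 2 * (K * D) * T + 3 * D ^ 3 * t ^ 3 := by ring
      _ ≤ 1 * (K * D) * S + 3 * D ^ 3 * S := by gcongr
      _ = _ := by ring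
  have q3 : (t * (K * T) + 3 * (t ^ 2 * D ^ 2)) * (b * η) ≤ (K + 3 * D ^ 2) * (b * S) := by
    have : t * (K * T) + 3 * (t ^ 2 * D ^ 2) ≤ 1 * (K * 1) + 3 * (1 * D ^ 2) := by gcongr
    calc _ ≤ (1 * (K * 1) + 3 * (1 * D ^ 2)) * (b * S) := by gcongr
      _ = _ := by ring
  have q4 : a * W ≤ a * S := by gcongr
  have q5 : K₀ * W ≤ K₀ * S := by gcongr
  have q6 : K * T ≤ K * S := by gcongr
  have q7 : 0 ≤ K₀ * S := by positivity
  calc _ = 2 * (K * T) + 8 * (b * η) + 40 * (a * W) + 32 * (K₀ * W) +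
        2 * ((t * (K * T) + 3 * (t ^ 2 * D ^ 2)) * (t * D)) +
        8 * ((t * (K * T) + 3 * (t ^ 2 * D ^ 2)) * (b * η)) := by ring
    _ ≤ 2 * (K * S) + 8 * (b * S) + 40 * (a * S) + 32 * (K₀ * S) +
        2 * ((K * D + 3 * D ^ 3) * S) + 8 * ((K + 3 * D ^ 2) * (b * S)) +
        (4 * S + 16 * (K₀ * S)) := by linarith
    _ = _ := by ring

/-- The characteristic function of a Birkhoff sum of an observable with vanishing conditional means
is close to a power of the characteristic function of the observable. -/
lemma exists_norm_charFun_sub_pow_le (M₀ : ℕ) {K₀ K₁ : ℝ} (hK₀ : 0 < K₀) (hK₁ : 0 < K₁)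
    {m : Torus2 → ℝ} {α K : ℝ≥0} (hα : 0 < α) (hα1 : α ≤ 1) (hm : HolderWith K α m) {C₀ : ℝ}
    (hC₀ : ∀ p, |m p| ≤ C₀) (hmean : ∀ y, ∫ x, m (x, y) = 0) :
    ∃ C : ℝ, 0 < C ∧ ∀ (F : ℕ → ℝ → ℝ) (ℓ : ℕ → ℝ) (Λ η θ : ℝ), (∀ n, Λ ≤ ℓ n) →
      (∀ n, Admissible M₀ K₀ K₁ (ℓ n) (F (n + 1))) → 0 < η → η ≤ 1 → C ≤ Λ * η ^ 2 → |θ| ≤ 1 →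
      ∀ n : ℕ, ‖(∫ p, Complex.exp ((θ * ∑ i ∈ Finset.range n, m (comp F i p) : ℝ) * Complex.I)) -
        (∫ p, Complex.exp ((θ * m p : ℝ) * Complex.I)) ^ n‖ ≤
        n * (C * (|θ| ^ 3 + η ^ (α : ℝ) + 1 / (Λ * η ^ 2))) := by
  obtain ⟨C', hC', hsmooth⟩ := exists_smooth_approx hα hm hC₀
  obtain ⟨τ, Cτ, hCτ, hτ, hτ', hτ0, hτ1, hτz, hτone⟩ := exists_cutoff
  have hC₀0 : 0 ≤ C₀ := (abs_nonneg _).trans (hC₀ (0, 0))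
  have hK0 : (0 : ℝ) ≤ K := K.2
  set D := C₀ + K with hD
  have hD0 : 0 ≤ D := add_nonneg hC₀0 hK0
  refine ⟨4 + 16 * K₀ + (8 * (M₀ * K₁) + 2 * (20 * (Cτ * K₀ + C') + 16 * K₀) +
    2 * (K * D) + 6 * D ^ 3 + 8 * (K + 3 * D ^ 2) * (M₀ * K₁) + 2 * K), by positivity, ?_⟩
  intro F ℓ Λ η θ hℓ hF hη hη1 hΛ hθ n
  obtain ⟨M, hMs, hMd, hMm, hMx, hMy⟩ := hsmooth η hη hη1
  have hα' : (0 : ℝ) < α := hα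
  have hα1' : (α : ℝ) ≤ 1 := hα1
  set T := η ^ (α : ℝ) with hT
  have hT0 : 0 ≤ T := by positivity
  have hT1 : T ≤ 1 := Real.rpow_le_one hη.le hη1 hα'.le
  have hηT : η ≤ T := by
    have := Real.rpow_le_rpow_of_exponent_ge hη hη1 hα1'
    rwa [Real.rpow_one] at this
  have hrest : 0 ≤ 8 * (M₀ * K₁) + 2 * (20 * (Cτ * K₀ + C') + 16 * K₀) +
    2 * (K * D) + 6 * D ^ 3 + 8 * (K + 3 * D ^ 2) * (M₀ * K₁) + 2 * K := by positivity
  have hΛ4 : 4 ≤ Λ * η ^ 2 := by linarith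
  have hΛ16 : 16 * K₀ ≤ Λ * η ^ 2 := by linarith
  have hη2 : 0 < η ^ 2 := by positivity
  have hΛ0 : 0 < Λ := by
    by_contra h
    have : Λ * η ^ 2 ≤ 0 := mul_nonpos_of_nonpos_of_nonneg (not_lt.1 h) hη2.le
    linarith
  have hMabs : ∀ p, |M p| ≤ D := fun p => by
    have h1 := hMm p.1 p.2
    have h2 := hC₀ ((p.1 : UnitAddCircle), (p.2 : UnitAddCircle))
    have h3 : (K : ℝ) * T ≤ K * 1 := by gcongr
    have h4 := abs_sub_abs_le_abs_sub (M (p.1, p.2))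
      (m ((p.1 : UnitAddCircle), (p.2 : UnitAddCircle)))
    have : M p = M (p.1, p.2) := rfl
    rw [this]
    linarith
  set e : ℝ × ℝ → ℂ := fun p => Complex.exp ((θ * M p : ℝ) * Complex.I) with he_def
  have he : Observable (C' / η) e := observable_cexp hMs hθ hMd hMx hMy
  have hB0 : 0 ≤ Cτ * K₀ / η := by positivity
  have he' : Observable (Cτ * K₀ / η + C' / η) e :=
    ⟨he.contDiff, fun p => (he.fderiv_le p).trans (by linarith), he.norm_le_one, he.periodic_fst,
      he.periodic_snd⟩
  have H := decorrelating_of_admissible hK₀ hℓ hF hη hη1 hΛ4 hΛ16 hτ hτ' hτ0 hτ1 hτz he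
  have hb₁ : ∀ p, ‖e p - 1‖ ≤ |θ| * D := fun p => by
    refine (norm_cexp_sub_one_le _).trans ?_
    rw [abs_mul]
    gcongr
    exact hMabs p
  have hMc : ∀ y, Continuous fun v => M (v, y) := fun y =>
    hMs.continuous.comp (by fun_prop : Continuous fun v : ℝ => (v, y))
  have hmc := hm.continuous hα
  have hmean' : ∀ y : ℝ, |∫ v in (0 : ℝ)..1, M (v, y)| ≤ K * T := fun y => by
    have h1 : ∫ v in (0 : ℝ)..1, m ((v : UnitAddCircle), (y : UnitAddCircle)) = 0 := by
      rw [← integral_circle fun x => m (x, (y : UnitAddCircle))]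
      exact hmean y
    have h2 : Continuous fun v : ℝ => m ((v : UnitAddCircle), (y : UnitAddCircle)) :=
      hmc.comp ((AddCircle.continuous_mk' 1).prodMk continuous_const)
    have h3 : ∫ v in (0 : ℝ)..1, M (v, y) = ∫ v in (0 : ℝ)..1,
        (M (v, y) - m ((v : UnitAddCircle), (y : UnitAddCircle))) := by
      rw [intervalIntegral.integral_sub ((hMc y).intervalIntegrable _ _)
        (h2.intervalIntegrable _ _), h1, sub_zero]
    rw [h3, ← Real.norm_eq_abs]
    refine (intervalIntegral.norm_integral_le_of_norm_le_const fun v _ => hMm v y).trans ?_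
    simp
  have hb₂ : ∀ y, ‖mean e y - 1‖ ≤ |θ| * (K * T) + 3 * (θ ^ 2 * D ^ 2) := fun y => by
    have hec : Continuous fun v => e (v, y) :=
      he.contDiff.continuous.comp (by fun_prop : Continuous fun v : ℝ => (v, y))
    have hlin : Continuous fun v => ((θ * M (v, y) : ℝ) : ℂ) * Complex.I :=
      (Complex.continuous_ofReal.comp (continuous_const.mul (hMc y))).mul continuous_const
    have h1 : mean e y - 1 = (∫ v in (0 : ℝ)..1, (e (v, y) - 1 - (θ * M (v, y) : ℝ) * Complex.I)) +
        ((θ * ∫ v in (0 : ℝ)..1, M (v, y) : ℝ) : ℂ) * Complex.I := by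
      have h2 : Continuous fun v => e (v, y) - 1 := hec.sub continuous_const
      rw [intervalIntegral.integral_sub (h2.intervalIntegrable _ _)
        (hlin.intervalIntegrable _ _), intervalIntegral.integral_sub (hec.intervalIntegrable _ _)
        intervalIntegrable_const, intervalIntegral.integral_mul_const,
        intervalIntegral.integral_ofReal, intervalIntegral.integral_const_mul]
      simp [mean]
    rw [h1, add_comm]
    refine (norm_add_le _ _).trans (add_le_add ?_ ?_)
    · rw [norm_mul, Complex.norm_I, mul_one, Complex.norm_real, Real.norm_eq_abs, abs_mul]
      gcongr
      exact hmean' y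
    · refine norm_integral_le_of_abs_le (h := fun v => e (v, y) - 1 -
        ((θ * M (v, y) : ℝ) : ℂ) * Complex.I) (fun v => ?_) zero_le_one le_rfl
      refine (norm_cexp_sub_one_sub_le _).trans ?_
      rw [mul_pow]
      have := hMabs (v, y)
      have : M (v, y) ^ 2 ≤ D ^ 2 := sq_le_sq' (by linarith [abs_le.1 this]) (abs_le.1 this).2
      gcongr
  have main := H.norm_integral_prod_sub_pow_le he'
    (χ := fun i x => τ (deriv (F (i + 1)) x / (ℓ i * η)))
    (fun i => hτ.continuous.measurable.comp ((measurable_deriv _).div_const _)) (fun i x => hτ0 _)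
    (fun i x => hτ1 _) (fun i => ((hF i).integral_cutoff_le hK₁ (hΛ0.trans_le (hℓ i)) hη hτ0 hτ1
      hτone).trans_eq (by ring : _ = 4 * (M₀ * K₁) * η)) hb₁ hb₂ n
  -- replacing the mollified observable by the observable itself
  have hclose : ∀ p, ‖Complex.exp ((θ * m p : ℝ) * Complex.I) - descend e p‖ ≤ K * T := fun p => by
    obtain ⟨x, y⟩ := p
    obtain ⟨x, rfl⟩ := QuotientAddGroup.mk_surjective x
    obtain ⟨y, rfl⟩ := QuotientAddGroup.mk_surjective y
    have h1 := descend_coe he.periodic_fst he.periodic_snd x y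
    change ‖_ - descend e ((x : UnitAddCircle), (y : UnitAddCircle))‖ ≤ _
    rw [h1]
    refine (norm_cexp_sub_cexp_le _ _).trans ?_
    rw [← mul_sub, abs_mul, abs_sub_comm]
    calc _ ≤ 1 * ((K : ℝ) * T) := mul_le_mul hθ (hMm x y) (abs_nonneg _) zero_le_one
      _ = _ := one_mul _
  have hcm : ∀ i, Measurable (comp F i) := fun i =>
    (measurePreserving_comp H.measurable i).measurable
  have hmm : Measurable m := hmc.measurable
  have hem := measurable_descend he.contDiff.continuous.measurable
  have hexp : Measurable fun p => Complex.exp ((θ * m p : ℝ) * Complex.I) :=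
    (Complex.measurable_exp.comp ((Complex.measurable_ofReal.comp
      (hmm.const_mul θ)).mul_const Complex.I))
  have hexp1 : ∀ p, ‖Complex.exp ((θ * m p : ℝ) * Complex.I)‖ ≤ 1 :=
    fun p => (Complex.norm_exp_ofReal_mul_I _).le
  have hprod : ∀ p, Complex.exp ((θ * ∑ i ∈ Finset.range n, m (comp F i p) : ℝ) * Complex.I) =
      ∏ i ∈ Finset.range n, Complex.exp ((θ * m (comp F i p) : ℝ) * Complex.I) := fun p => by
    rw [← Complex.exp_sum, Finset.mul_sum, ← Finset.sum_mul]
    push_cast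
    rfl
  have t1 : ‖(∫ p, Complex.exp ((θ * ∑ i ∈ Finset.range n, m (comp F i p) : ℝ) * Complex.I)) -
      ∫ p, ∏ i ∈ Finset.range n, descend e (comp F i p)‖ ≤ n * (K * T) := by
    simp only [hprod]
    have j1 : Integrable fun p =>
        ∏ i ∈ Finset.range n, Complex.exp ((θ * m (comp F i p) : ℝ) * Complex.I) := by
      refine integrable_of_norm_le (c := 1) (Finset.measurable_fun_prod _ fun i _ =>
        hexp.comp (hcm i)) fun p => ?_
      rw [norm_prod]
      exact Finset.prod_le_one (fun _ _ => norm_nonneg _) fun i _ => hexp1 _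
    have j2 : Integrable fun p => ∏ i ∈ Finset.range n, descend e (comp F i p) := by
      refine integrable_of_norm_le (c := 1) (Finset.measurable_fun_prod _ fun i _ =>
        hem.comp (hcm i)) fun p => ?_
      rw [norm_prod]
      exact Finset.prod_le_one (fun _ _ => norm_nonneg _) fun i _ => he.norm_le_one _
    rw [← integral_sub j1 j2]
    refine (norm_integral_le_of_norm_le_const (C := n * (K * T))
      (Eventually.of_forall fun p => ?_)).trans (by simp)
    refine (norm_prod_sub_prod_le _ (fun i => hexp1 _) (fun i => he.norm_le_one _)).trans ?_
    refine (Finset.sum_le_card_nsmul _ _ (K * T) fun i _ => hclose _).trans_eq ?_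
    simp
  have t2 : ‖(∫ p, descend e p) ^ n - (∫ p, Complex.exp ((θ * m p : ℝ) * Complex.I)) ^ n‖ ≤
      n * (K * T) := by
    have n1 : ‖∫ p, descend e p‖ ≤ 1 := (norm_integral_le_of_norm_le_const
      (Eventually.of_forall fun p => he.norm_le_one _)).trans (by simp)
    have n2 : ‖∫ p, Complex.exp ((θ * m p : ℝ) * Complex.I)‖ ≤ 1 :=
      (norm_integral_le_of_norm_le_const (Eventually.of_forall hexp1)).trans (by simp)
    have n3 := norm_prod_sub_prod_le (Finset.range n) (fun _ => n1) (fun _ => n2)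
    simp only [Finset.prod_const, Finset.sum_const, Finset.card_range, nsmul_eq_mul] at n3
    refine n3.trans ?_
    gcongr
    rw [norm_sub_rev, ← integral_sub (integrable_of_norm_le hexp hexp1)
      (integrable_of_norm_le hem fun p => he.norm_le_one _)]
    exact (norm_integral_le_of_norm_le_const (Eventually.of_forall hclose)).trans (by simp)
  refine (norm_sub_le_norm_sub_add_norm_sub _
    (∫ p, ∏ i ∈ Finset.range n, descend e (comp F i p)) _).trans ?_
  refine (add_le_add t1 (norm_sub_le_norm_sub_add_norm_sub _ ((∫ p, descend e p) ^ n) _)).trans ?_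
  refine (add_le_add le_rfl (add_le_add main t2)).trans ?_
  rw [← mul_add, ← mul_add]
  refine mul_le_mul_of_nonneg_left ?_ (Nat.cast_nonneg n)
  have r1 : 10 * (Cτ * K₀ / η + C' / η) / (Λ * η / 2) =
      20 * (Cτ * K₀ + C') * (1 / (Λ * η ^ 2)) := by
    field_simp; ring
  have r2 : 4 * K₀ / (Λ * η ^ 2) = 4 * K₀ * (1 / (Λ * η ^ 2)) := by ring
  rw [r1, r2, ← sq_abs θ]
  exact error_le_mul_sum hK₀.le (by positivity) (by positivity) hK0 hD0 (abs_nonneg θ) hθ hT0 hT1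
    hη.le hηT (by positivity)

/-! ### The martingale-coboundary decomposition -/

/-- The mean of a function on the torus over its first variable. -/
noncomputable def condMean (φ : Torus2 → ℝ) (y : UnitAddCircle) : ℝ := ∫ x, φ (x, y)

/-- The observable cohomologous to `φ` whose means over the first variable vanish if `φ` has mean
zero: along independent uniform variables it is a martingale difference. -/
noncomputable def martingalePart (φ : Torus2 → ℝ) (p : Torus2) : ℝ :=
  φ p - condMean φ p.2 + condMean φ p.1

section Decomposition

variable {φ : Torus2 → ℝ} {α C : ℝ≥0}

lemma integrable_of_continuous {X : Type*} [TopologicalSpace X] [CompactSpace X]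
    [MeasurableSpace X] [BorelSpace X] {μ : Measure X} [IsFiniteMeasure μ] {φ : X → ℝ}
    (hφ : Continuous φ) : Integrable φ μ :=
  hφ.integrable_of_hasCompactSupport (HasCompactSupport.of_compactSpace φ)

lemma holderWith_of_dist_le {X : Type*} [PseudoMetricSpace X] {f : X → ℝ} {C α : ℝ≥0}
    (h : ∀ x y, dist (f x) (f y) ≤ C * dist x y ^ (α : ℝ)) : HolderWith C α f := by
  intro x y
  rw [edist_dist, edist_dist, ENNReal.ofReal_rpow_of_nonneg dist_nonneg α.coe_nonneg,
    ← ENNReal.ofReal_coe_nnreal, ← ENNReal.ofReal_mul C.coe_nonneg]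
  exact ENNReal.ofReal_le_ofReal (h x y)

lemma holderWith_condMean (hα : 0 < α) (hφ : HolderWith C α φ) : HolderWith C α (condMean φ) := by
  have hc := hφ.continuous hα
  have hint : ∀ y, Integrable fun x => φ (x, y) := fun y =>
    integrable_of_continuous (hc.comp (by fun_prop))
  refine holderWith_of_dist_le fun y y' => ?_
  rw [dist_eq_norm, condMean, condMean, ← integral_sub (hint y) (hint y')]
  refine (norm_integral_le_of_norm_le_const (C := C * dist y y' ^ (α : ℝ))
    (Eventually.of_forall fun x => ?_)).trans (by simp)
  rw [← dist_eq_norm]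
  refine (hφ.dist_le _ _).trans_eq ?_
  simp [Prod.dist_eq]

lemma holderWith_martingalePart (hα : 0 < α) (hφ : HolderWith C α φ) :
    HolderWith (C + C + C) α (martingalePart φ) := by
  have h1 := holderWith_condMean hα hφ
  refine holderWith_of_dist_le fun p p' => ?_
  have a1 := hφ.dist_le p p'
  have a2 := h1.dist_le p.2 p'.2
  have a3 := h1.dist_le p.1 p'.1
  have b2 : dist p.2 p'.2 ^ (α : ℝ) ≤ dist p p' ^ (α : ℝ) :=
    Real.rpow_le_rpow dist_nonneg (le_max_right _ _) α.2
  have b3 : dist p.1 p'.1 ^ (α : ℝ) ≤ dist p p' ^ (α : ℝ) :=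
    Real.rpow_le_rpow dist_nonneg (le_max_left _ _) α.2
  have c2 := mul_le_mul_of_nonneg_left b2 C.2
  have c3 := mul_le_mul_of_nonneg_left b3 C.2
  have e := dist_add_add_le (φ p - condMean φ p.2) (condMean φ p.1) (φ p' - condMean φ p'.2)
    (condMean φ p'.1)
  have e' := dist_sub_sub_le (φ p) (condMean φ p.2) (φ p') (condMean φ p'.2)
  simp only [martingalePart]
  push_cast
  simp only [NNReal.val_eq_coe] at c2 c3
  linarith

lemma integral_torus {G : Torus2 → ℝ} (hG : Continuous G) : ∫ p, G p = ∫ y, ∫ x, G (x, y) :=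
  integral_prod_symm G (integrable_of_continuous hG)

lemma integral_condMean (hφ : Continuous φ) (h0 : ∫ p, φ p = 0) : ∫ y, condMean φ y = 0 := by
  rw [← h0, integral_torus hφ]; rfl

lemma integral_martingalePart_fst (hα : 0 < α) (hφ : HolderWith C α φ) (h0 : ∫ p, φ p = 0)
    (y : UnitAddCircle) : ∫ x, martingalePart φ (x, y) = 0 := by
  have hc := hφ.continuous hα
  have hm := (holderWith_condMean hα hφ).continuous hα
  have h1 : Integrable fun x => φ (x, y) := integrable_of_continuous (hc.comp (by fun_prop))
  have h2 : Integrable (condMean φ) := integrable_of_continuous hm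
  simp only [martingalePart]
  have h3 : Integrable fun x => φ (x, y) - condMean φ y := h1.sub (integrable_const _)
  rw [integral_add h3 h2, integral_sub h1 (integrable_const _),
    integral_condMean hc h0]
  simp [condMean]

/-- The square of the martingale part integrates to the asymptotic variance. The square and
cross terms of the conditional mean `ψ` cancel except for `∫ φ (x, y) ψ x`, which is the triple
integral. -/
lemma integral_martingalePart_sq (hα : 0 < α) (hφ : HolderWith C α φ) (h0 : ∫ p, φ p = 0) :
    ∫ p, martingalePart φ p ^ 2 = asympVar φ := by
  have hc := hφ.continuous hα
  have hm := (holderWith_condMean hα hφ).continuous hα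
  set ψ := condMean φ with hψ
  have hψ0 : ∫ y, ψ y = 0 := integral_condMean hc h0
  set I := ∫ y, ψ y ^ 2 with hI
  set J := ∫ p : Torus2, φ p * ψ p.1 with hJ
  have c1 : Continuous fun p : Torus2 => φ p ^ 2 := hc.pow 2
  have c2 : Continuous fun p : Torus2 => ψ p.2 ^ 2 := by fun_prop
  have c3 : Continuous fun p : Torus2 => ψ p.1 ^ 2 := by fun_prop
  have c4 : Continuous fun p : Torus2 => φ p * ψ p.2 := by fun_prop
  have c5 : Continuous fun p : Torus2 => φ p * ψ p.1 := by fun_prop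
  have c6 : Continuous fun p : Torus2 => ψ p.1 * ψ p.2 := by fun_prop
  have i2 : ∫ p : Torus2, ψ p.2 ^ 2 = I := by rw [integral_torus c2]; simp [hI]
  have i3 : ∫ p : Torus2, ψ p.1 ^ 2 = I := by rw [integral_torus c3]; simp [hI]
  have i4 : ∫ p : Torus2, φ p * ψ p.2 = I := by
    rw [integral_torus c4, hI]
    refine integral_congr_ae (Eventually.of_forall fun y => ?_)
    simp only
    rw [integral_mul_const, sq]
    rfl
  have i6 : ∫ p : Torus2, ψ p.1 * ψ p.2 = 0 := by
    rw [integral_torus c6]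
    simp only [integral_mul_const, hψ0, zero_mul, integral_zero]
  have i7 : ∫ q : UnitAddCircle × UnitAddCircle × UnitAddCircle,
      φ (q.1, q.2.2) * φ (q.2.2, q.2.1) = J := by
    have c7 : Continuous fun q : UnitAddCircle × UnitAddCircle × UnitAddCircle =>
      φ (q.1, q.2.2) * φ (q.2.2, q.2.1) := by fun_prop
    have e1 : ∫ q : UnitAddCircle × UnitAddCircle × UnitAddCircle,
        φ (q.1, q.2.2) * φ (q.2.2, q.2.1) =
        ∫ p : Torus2, ∫ x, φ (x, p.2) * φ (p.2, p.1) :=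
      integral_prod_symm _ (integrable_of_continuous c7)
    have e2 : ∫ p : Torus2, φ p.swap * ψ p.swap.1 = J :=
      integral_prod_swap (fun p : Torus2 => φ p * ψ p.1)
    rw [e1, ← e2]
    refine integral_congr_ae (Eventually.of_forall fun p => ?_)
    simp only
    rw [integral_mul_const, mul_comm]
    rfl
  have key : ∀ p, martingalePart φ p ^ 2 = φ p ^ 2 + ψ p.2 ^ 2 + ψ p.1 ^ 2 - 2 * (φ p * ψ p.2) +
      2 * (φ p * ψ p.1) - 2 * (ψ p.1 * ψ p.2) := fun p => by
    simp only [martingalePart, ← hψ]; ring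
  have n1 := integrable_of_continuous (μ := (volume : Measure Torus2)) c1
  have n2 := integrable_of_continuous (μ := (volume : Measure Torus2)) c2
  have n3 := integrable_of_continuous (μ := (volume : Measure Torus2)) c3
  have n4 := (integrable_of_continuous (μ := (volume : Measure Torus2)) c4).const_mul 2
  have n5 := (integrable_of_continuous (μ := (volume : Measure Torus2)) c5).const_mul 2
  have n6 := (integrable_of_continuous (μ := (volume : Measure Torus2)) c6).const_mul 2
  have s2 : Integrable fun p : Torus2 => φ p ^ 2 + ψ p.2 ^ 2 := n1.add n2
  have s3 : Integrable fun p : Torus2 => φ p ^ 2 + ψ p.2 ^ 2 + ψ p.1 ^ 2 := s2.add n3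
  have s4 : Integrable fun p : Torus2 => φ p ^ 2 + ψ p.2 ^ 2 + ψ p.1 ^ 2 - 2 * (φ p * ψ p.2) :=
    s3.sub n4
  have s5 : Integrable fun p : Torus2 => φ p ^ 2 + ψ p.2 ^ 2 + ψ p.1 ^ 2 - 2 * (φ p * ψ p.2) +
    2 * (φ p * ψ p.1) := s4.add n5
  simp only [key]
  rw [integral_sub s5 n6, integral_add s4 n5, integral_sub s3 n4, integral_add s2 n3,
    integral_add n1 n2, integral_const_mul, integral_const_mul,
    integral_const_mul, i2, i3, i4, i6, asympVar, i7]
  ring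

lemma asympVar_eq_zero_iff (hα : 0 < α) (hφ : HolderWith C α φ) (h0 : ∫ p, φ p = 0) :
    asympVar φ = 0 ↔
      ∃ ψ : UnitAddCircle → ℝ, Continuous ψ ∧ ∀ x y, φ (x, y) = ψ x - ψ y := by
  have hm := (holderWith_condMean hα hφ).continuous hα
  have hM := (holderWith_martingalePart hα hφ).continuous hα
  rw [← integral_martingalePart_sq hα hφ h0]
  constructor
  · intro h
    have h1 := (integral_eq_zero_iff_of_nonneg (fun p => sq_nonneg (martingalePart φ p))
      (integrable_of_continuous (hM.pow 2))).1 h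
    have h2 : (fun p => martingalePart φ p ^ 2) = 0 :=
      (Continuous.ae_eq_iff_eq volume (hM.pow 2) continuous_const).1 h1
    refine ⟨fun x => -condMean φ x, hm.neg, fun x y => ?_⟩
    have h3 : martingalePart φ (x, y) = 0 := pow_eq_zero_iff two_ne_zero |>.1 (congrFun h2 (x, y))
    simp only [martingalePart] at h3
    linarith
  · rintro ⟨ψ, hψ, h⟩
    have h1 : ∀ y, condMean φ y = (∫ x, ψ x) - ψ y := fun y => by
      simp only [condMean, h]
      rw [integral_sub (integrable_of_continuous hψ) (integrable_const _)]
      simp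
    have h2 : ∀ p, martingalePart φ p = 0 := fun p => by
      have := h p.1 p.2
      simp only [martingalePart, h1]
      rw [show p = (p.1, p.2) from rfl, this]
      ring
    simp [h2]

/-- Along orbits, the coboundary in the decomposition telescopes. -/
lemma abs_sum_sub_sum_martingalePart_le {C₀ : ℝ} (hC₀ : ∀ y, |condMean φ y| ≤ C₀)
    (F : ℕ → ℝ → ℝ) (n : ℕ) (p : Torus2) :
    |∑ i ∈ Finset.range n, φ (comp F i p) - ∑ i ∈ Finset.range n, martingalePart φ (comp F i p)| ≤
      2 * C₀ := by
  have hC₀0 : 0 ≤ C₀ := (abs_nonneg _).trans (hC₀ 0)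
  cases n with
  | zero => simpa using hC₀0
  | succ n =>
    have key : ∑ i ∈ Finset.range (n + 1), φ (comp F i p) -
        ∑ i ∈ Finset.range (n + 1), martingalePart φ (comp F i p) =
        condMean φ p.2 - condMean φ (comp F n p).1 := by
      induction n with
      | zero => simp [martingalePart, comp]; ring
      | succ n ih =>
        rw [Finset.sum_range_succ, Finset.sum_range_succ _ (n + 1), add_sub_add_comm, ih]
        have : (comp F (n + 1) p).2 = (comp F n p).1 := rfl
        simp only [martingalePart, this]
        ring
    rw [key]
    refine (abs_sub _ _).trans ?_
    linarith [hC₀ p.2, hC₀ (comp F n p).1]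

end Decomposition

/-! ### The central limit theorem -/

/-- The growth hypothesis on the coefficients, read at times beyond `N ^ (1 / 4)`. -/
lemma eventually_rpow_le_coeff {α : ℝ} (hα : 0 < α) {L : ℕ → ℝ} (hL : ∀ n, 1 ≤ n → 0 < L n)
    (hlim : Tendsto (fun N : ℕ => (N : ℝ) ^ 8 * L N ^ (-(α / (3 * α + 4)))) atTop (𝓝 0)) :
    ∀ᶠ N : ℕ in atTop, ∀ j, N.sqrt.sqrt + 1 ≤ j → (N : ℝ) ^ (2 + 4 / α) ≤ L j := by
  set β := α / (3 * α + 4) with hβ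
  have hβ0 : 0 < β := by positivity
  obtain ⟨J, hJ⟩ := eventually_atTop.1 (hlim.eventually (gt_mem_nhds zero_lt_one))
  have hk : Tendsto (fun N : ℕ => N.sqrt.sqrt) atTop atTop := by
    refine tendsto_atTop.2 fun b => ?_
    filter_upwards [eventually_ge_atTop ((b * b) * (b * b))] with N hN
    exact Nat.le_sqrt.2 (Nat.le_sqrt.2 hN)
  filter_upwards [hk.eventually_ge_atTop J, eventually_ge_atTop 1] with N hN hN1 j hj
  have hLj : 0 < L j := hL j (by omega)
  have h1 := hJ j (by omega)
  have h2 : (j : ℝ) ^ 8 ≤ L j ^ β := by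
    rw [Real.rpow_neg hLj.le, ← div_eq_mul_inv, div_lt_one (by positivity)] at h1
    exact h1.le
  have h3 : N ≤ j ^ 4 := by
    have a1 : N < N.sqrt.succ * N.sqrt.succ := Nat.lt_succ_sqrt N
    have a2 : N.sqrt < N.sqrt.sqrt.succ * N.sqrt.sqrt.succ := Nat.lt_succ_sqrt _
    have a3 : N.sqrt.succ ≤ j * j := a2.trans_le (Nat.mul_le_mul hj hj)
    calc N ≤ (j * j) * (j * j) := a1.le.trans (Nat.mul_le_mul a3 a3)
      _ = j ^ 4 := by ring
  have h4 : (N : ℝ) ^ 2 ≤ L j ^ β := by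
    have : (N : ℝ) ≤ (j : ℝ) ^ 4 := by exact_mod_cast h3
    calc (N : ℝ) ^ 2 ≤ ((j : ℝ) ^ 4) ^ 2 := by gcongr
      _ = (j : ℝ) ^ 8 := by ring
      _ ≤ _ := h2
  have hN1' : (1 : ℝ) ≤ N := by exact_mod_cast hN1
  calc (N : ℝ) ^ (2 + 4 / α) ≤ (N : ℝ) ^ (2 * β⁻¹) := by
        refine Real.rpow_le_rpow_of_exponent_le hN1' ?_
        have : 2 * β⁻¹ = 6 + 8 / α := by rw [hβ]; field_simp; ring
        rw [this]
        have : 4 / α ≤ 8 / α := by gcongr; norm_num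
        linarith
    _ = ((N : ℝ) ^ 2) ^ β⁻¹ := by
        rw [Real.rpow_mul (by positivity), Real.rpow_two]
    _ ≤ (L j ^ β) ^ β⁻¹ := Real.rpow_le_rpow (by positivity) h4 (by positivity)
    _ = L j := Real.rpow_rpow_inv hLj.le hβ0.ne'

/-- The central limit theorem for independent copies of `m`, in terms of characteristic
functions. -/
lemma tendsto_integral_cexp_pow {m : Torus2 → ℝ} (hm : Continuous m) {σ : ℝ} (hσ : 0 < σ)
    (h0 : ∫ p, m p = 0) (h2 : ∫ p, m p ^ 2 = σ ^ 2) (t : ℝ) :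
    Tendsto (fun N : ℕ => (∫ p, Complex.exp ((t / σ / √N * m p : ℝ) * Complex.I)) ^ N) atTop
      (𝓝 (Complex.exp (-t ^ 2 / 2))) := by
  have hX : Measurable fun p => m p / σ := hm.measurable.div_const σ
  have key := tendsto_charFun_inv_sqrt_mul_pow (P := (volume : Measure Torus2))
    (X := fun p => m p / σ) hX.aemeasurable ?_ ?_ t
  · refine key.congr fun N => ?_
    rw [charFun_apply_real, integral_map hX.aemeasurable (by fun_prop)]
    congr 2 with p
    congr 2
    rw [← Complex.ofReal_mul]
    congr 1
    ring
  · rw [integral_div, h0, zero_div]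
  · have : ∀ p, ((fun p => m p / σ) ^ 2) p = m p ^ 2 / σ ^ 2 := fun p => by
      rw [Pi.pow_apply, div_pow]
    simp only [this]
    rw [integral_div, h2, div_self (by positivity)]

lemma norm_integral_cexp_sub_le {X : Type*} [MeasurableSpace X] {μ : Measure X}
    [IsProbabilityMeasure μ] {a b : X → ℝ} (ha : Measurable a) (hb : Measurable b) {δ : ℝ}
    (h : ∀ x, |a x - b x| ≤ δ) :
    ‖(∫ x, Complex.exp (a x * Complex.I) ∂μ) - ∫ x, Complex.exp (b x * Complex.I) ∂μ‖ ≤ δ := by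
  have hi : ∀ a : X → ℝ, Measurable a → Integrable (fun x => Complex.exp (a x * Complex.I)) μ :=
    fun a ha => integrable_of_norm_le (c := 1) (by fun_prop)
      fun x => (Complex.norm_exp_ofReal_mul_I _).le
  rw [← integral_sub (hi a ha) (hi b hb)]
  refine (norm_integral_le_of_norm_le_const (C := δ) (Eventually.of_forall fun x => ?_)).trans
    (by simp)
  exact (norm_cexp_sub_cexp_le _ _).trans (h x)

lemma norm_pow_sub_pow_le {w : ℂ} (hw : ‖w‖ ≤ 1) {a b k : ℕ} {δ : ℝ} (hwδ : ‖w - 1‖ ≤ δ)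
    (h1 : a ≤ b + k) (h2 : b ≤ a + k) : ‖w ^ a - w ^ b‖ ≤ k * δ := by
  have hδ : 0 ≤ δ := (norm_nonneg _).trans hwδ
  have key : ∀ a j : ℕ, ‖w ^ (a + j) - w ^ a‖ ≤ j * δ := fun a j => by
    have h3 := norm_prod_sub_prod_le (Finset.range j) (a := fun _ => w) (b := fun _ => 1)
      (fun _ => hw) (fun _ => by simp)
    simp only [Finset.prod_const, Finset.card_range, one_pow, Finset.sum_const, nsmul_eq_mul] at h3
    calc ‖w ^ (a + j) - w ^ a‖ = ‖w‖ ^ a * ‖w ^ j - 1‖ := by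
          rw [← norm_pow, ← norm_mul]; congr 1; ring
      _ ≤ 1 * (j * δ) := by
          gcongr
          · exact pow_le_one₀ (norm_nonneg _) hw
          · exact h3.trans (by gcongr)
      _ = _ := one_mul _
  rcases le_total a b with h | h
  · obtain ⟨j, rfl⟩ := Nat.exists_eq_add_of_le h
    rw [norm_sub_rev]
    refine (key a j).trans ?_
    gcongr
    omega
  · obtain ⟨j, rfl⟩ := Nat.exists_eq_add_of_le h
    refine (key b j).trans ?_
    gcongr
    omega

/-- Comparison of the characteristic function of the normalized Birkhoff sum with a power: the
first `N ^ (1 / 4)` terms are dropped. -/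
lemma exists_norm_charFun_birkhoff_sub_le (M₀ : ℕ) {K₀ K₁ : ℝ} (hK₀ : 0 < K₀) (hK₁ : 0 < K₁)
    {φ : Torus2 → ℝ} {α K : ℝ≥0} (hα : 0 < α) (hα1 : α ≤ 1) (hφ : HolderWith K α φ)
    (h0 : ∫ p, φ p = 0) {L : ℕ → ℝ} {f : ℕ → ℝ → ℝ} (hL : ∀ n, 1 ≤ n → 0 < L n)
    (hf : ∀ n, 1 ≤ n → Admissible M₀ K₀ K₁ (L n) (f n))
    (hlim : Tendsto (fun N : ℕ => (N : ℝ) ^ 8 * L N ^ (-((α : ℝ) / (3 * (α : ℝ) + 4)))) atTop (𝓝 0))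
    (a : ℝ) :
    Tendsto (fun N : ℕ =>
      (∫ p, Complex.exp ((a / √N * ∑ i ∈ Finset.range (N + 1), φ (comp f i p) : ℝ) * Complex.I)) -
        (∫ p, Complex.exp ((a / √N * martingalePart φ p : ℝ) * Complex.I)) ^ N) atTop (𝓝 0) := by
  have hα' : (0 : ℝ) < α := hα
  have hφc := hφ.continuous hα
  have hmH := holderWith_martingalePart hα hφ
  have hmc := hmH.continuous hα
  have hψc := (holderWith_condMean hα hφ).continuous hα
  set m := martingalePart φ
  have hbdd : ∀ {X : Type} [TopologicalSpace X] [CompactSpace X] {g : X → ℝ}, Continuous g →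
      ∃ C, ∀ x, |g x| ≤ C := fun {X} _ _ {g} hg => by
    obtain ⟨C, hC⟩ := isCompact_univ.exists_bound_of_continuousOn hg.continuousOn
    exact ⟨C, fun x => hC x trivial⟩
  obtain ⟨Cφ, hCφ⟩ := hbdd hφc
  obtain ⟨Cm, hCm⟩ := hbdd hmc
  obtain ⟨Cψ, hCψ⟩ := hbdd hψc
  have hCφ0 := (abs_nonneg _).trans (hCφ 0)
  have hCm0 := (abs_nonneg _).trans (hCm 0)
  have hCψ0 := (abs_nonneg _).trans (hCψ 0)
  obtain ⟨C, hC, hmain⟩ := exists_norm_charFun_sub_pow_le M₀ hK₀ hK₁ hα hα1 hmH hCm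
    (integral_martingalePart_fst hα hφ h0)
  have hr : Tendsto (fun N : ℕ => √√(N : ℝ)) atTop atTop :=
    Real.tendsto_sqrt_atTop.comp (Real.tendsto_sqrt_atTop.comp tendsto_natCast_atTop_atTop)
  have hmeas : ∀ n, 1 ≤ n → Measurable (f n) := fun n hn => (hf n hn).contDiff.continuous.measurable
  have hbound : ∀ᶠ N : ℕ in atTop,
      ‖(∫ p, Complex.exp ((a / √N * ∑ i ∈ Finset.range (N + 1), φ (comp f i p) : ℝ) * Complex.I)) -
        (∫ p, Complex.exp ((a / √N * m p : ℝ) * Complex.I)) ^ N‖ ≤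
      (|a| * (Cφ + 2 * Cψ) + 2 * (C * (|a| ^ 3 + 2)) + 2 * (|a| * Cm)) * (√√(N : ℝ))⁻¹ := by
    filter_upwards [eventually_rpow_le_coeff hα' hL hlim, hr.eventually_ge_atTop (1 + |a| + C)]
      with N hN hrN
    set r := √√(N : ℝ) with hr_def
    have ha0 := abs_nonneg a
    have hr1 : 1 ≤ r := by linarith
    have hr0 : 0 < r := by linarith
    have hr2 : √(N : ℝ) = r ^ 2 := (Real.sq_sqrt (Real.sqrt_nonneg _)).symm
    have hr4 : (N : ℝ) = r ^ 4 := by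
      rw [show r ^ 4 = (r ^ 2) ^ 2 by ring, ← hr2, Real.sq_sqrt (Nat.cast_nonneg N)]
    have hN1 : (1 : ℝ) ≤ N := by rw [hr4]; exact one_le_pow₀ hr1
    have hN1' : 1 ≤ N := by exact_mod_cast hN1
    set k := N.sqrt.sqrt with hk
    have hkN : k ≤ N := (Nat.sqrt_le_self _).trans (Nat.sqrt_le_self _)
    have hkr : (k : ℝ) ≤ r := by
      refine Real.le_sqrt_of_sq_le (Real.le_sqrt_of_sq_le ?_)
      have h1 : k ^ 2 ≤ N.sqrt := Nat.sqrt_le' _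
      have h2 : N.sqrt ^ 2 ≤ N := Nat.sqrt_le' _
      exact_mod_cast (Nat.pow_le_pow_left h1 2).trans h2
    obtain ⟨n, hn⟩ : ∃ n, N + 1 = k + n := ⟨N + 1 - k, by omega⟩
    set θ := a / √(N : ℝ) with hθ
    have hθabs : |θ| = |a| / r ^ 2 := by
      rw [hθ, abs_div, hr2, abs_of_pos (by positivity : 0 < r ^ 2)]
    have hθr : |θ| * r = |a| * r⁻¹ := by rw [hθabs]; field_simp
    have hθ0 := abs_nonneg θ
    have hθ1 : |θ| ≤ 1 := by
      rw [hθabs, div_le_one (by positivity)]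
      nlinarith
    set g : ℕ → ℝ → ℝ := fun n => f (k + n) with hg
    have hgm : ∀ n, Measurable (g (n + 1)) := fun n => hmeas _ (by omega)
    have hfm : ∀ n, Measurable (f (n + 1)) := fun n => hmeas _ (by omega)
    have hfc : ∀ n, Measurable (comp f n) := fun n => (measurePreserving_comp hfm n).measurable
    have hgc : ∀ n, Measurable (comp g n) := fun n => (measurePreserving_comp hgm n).measurable
    have hmk := measurePreserving_comp hfm k
    -- these scales make `η ^ α` and `1 / (Λ * η ^ 2)` both equal to `N ^ (-2)`
    set Λ := (N : ℝ) ^ (2 + 4 / (α : ℝ)) with hΛ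
    set η := (N : ℝ) ^ (-(2 / (α : ℝ))) with hη
    have hN0 : (0 : ℝ) < N := by linarith
    have hηα : η ^ (α : ℝ) = ((N : ℝ) ^ 2)⁻¹ := by
      rw [hη, ← Real.rpow_mul hN0.le, neg_mul, div_mul_cancel₀ _ hα'.ne', Real.rpow_neg hN0.le,
        Real.rpow_two]
    have hΛη : Λ * η ^ 2 = (N : ℝ) ^ 2 := by
      rw [hη, ← Real.rpow_natCast, ← Real.rpow_mul hN0.le, hΛ, ← Real.rpow_add hN0,
        ← Real.rpow_natCast (N : ℝ)]
      congr 1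
      push_cast
      ring
    have hη1 : η ≤ 1 := Real.rpow_le_one_of_one_le_of_nonpos hN1 (by
      have : 0 ≤ 2 / (α : ℝ) := by positivity
      linarith)
    have hCN : C ≤ (N : ℝ) ^ 2 := by
      have h1 : C ≤ r := by linarith
      have h2 : r ≤ r ^ 8 := le_self_pow₀ hr1 (by norm_num)
      have h3 : (N : ℝ) ^ 2 = r ^ 8 := by rw [hr4]; ring
      rw [h3]; linarith
    have hmain' := hmain g (fun n => L (k + (n + 1))) Λ η θ (fun n => hN _ (by omega))
      (fun n => hf _ (by omega)) (by positivity) hη1 (by rw [hΛη]; exact hCN) hθ1 n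
    rw [hηα, hΛη] at hmain'
    set w := ∫ p, Complex.exp ((θ * m p : ℝ) * Complex.I) with hw
    -- the sum from time `k` on, over the orbit of the image point, replaces the whole sum
    have b1 : ‖(∫ p, Complex.exp ((θ * ∑ i ∈ Finset.range (N + 1), φ (comp f i p) : ℝ) *
        Complex.I)) - ∫ p, Complex.exp ((θ * ∑ i ∈ Finset.range n, m (comp g i p) : ℝ) *
        Complex.I)‖ ≤ |θ| * (k * Cφ + 2 * Cψ) := by
      have hS : Measurable fun p => θ * ∑ i ∈ Finset.range n, m (comp g i p) :=
        (Finset.measurable_fun_sum _ fun i _ => hmc.measurable.comp (hgc i)).const_mul θ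
      have e1 : (∫ p, Complex.exp ((θ * ∑ i ∈ Finset.range n, m (comp g i p) : ℝ) * Complex.I)) =
          ∫ p, Complex.exp ((θ * ∑ i ∈ Finset.range n, m (comp g i (comp f k p)) : ℝ) *
            Complex.I) := by
        have hE : Measurable fun p =>
            Complex.exp ((θ * ∑ i ∈ Finset.range n, m (comp g i p) : ℝ) * Complex.I) := by
          fun_prop
        conv_lhs => rw [← hmk.map_eq]
        rw [integral_map hmk.measurable.aemeasurable hE.aestronglyMeasurable]
      rw [e1]
      refine norm_integral_cexp_sub_le
        ((Finset.measurable_fun_sum _ fun i _ => hφc.measurable.comp (hfc i)).const_mul θ)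
        (hS.comp hmk.measurable) fun p => ?_
      change |θ * ∑ i ∈ Finset.range (N + 1), φ (comp f i p) -
        θ * ∑ i ∈ Finset.range n, m (comp g i (comp f k p))| ≤ _
      rw [← mul_sub, abs_mul]
      gcongr
      have e2 : ∑ i ∈ Finset.range (N + 1), φ (comp f i p) =
          ∑ i ∈ Finset.range k, φ (comp f i p) +
            ∑ i ∈ Finset.range n, φ (comp g i (comp f k p)) := by
        rw [hn, Finset.sum_range_add]
        simp only [comp_add]
        rfl
      rw [e2, add_sub_assoc]
      refine (abs_add_le _ _).trans (add_le_add ?_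
        (abs_sum_sub_sum_martingalePart_le hCψ g n _))
      refine (Finset.abs_sum_le_sum_abs _ _).trans
        ((Finset.sum_le_card_nsmul _ _ Cφ fun i _ => hCφ _).trans_eq (by simp))
    have hw1 : ‖w‖ ≤ 1 := (norm_integral_le_of_norm_le_const
      (Eventually.of_forall fun p => (Complex.norm_exp_ofReal_mul_I _).le)).trans (by simp)
    have hwδ : ‖w - 1‖ ≤ |θ| * Cm := by
      have := norm_integral_cexp_sub_le (μ := (volume : Measure Torus2)) (a := fun p => θ * m p)
        (b := fun _ => 0) (δ := |θ| * Cm) (hmc.measurable.const_mul θ) measurable_const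
        (fun p => by rw [sub_zero, abs_mul]; gcongr; exact hCm p)
      have e : (∫ _ : Torus2, Complex.exp (((0 : ℝ) : ℂ) * Complex.I)) = 1 := by simp
      rwa [e] at this
    have b3 : ‖w ^ n - w ^ N‖ ≤ ((k + 1 : ℕ) : ℝ) * (|θ| * Cm) :=
      norm_pow_sub_pow_le hw1 hwδ (by omega) (by omega)
    refine (norm_sub_le_norm_sub_add_norm_sub _
      (∫ p, Complex.exp ((θ * ∑ i ∈ Finset.range n, m (comp g i p) : ℝ) * Complex.I)) _).trans ?_
    refine (add_le_add b1 ((norm_sub_le_norm_sub_add_norm_sub _ (w ^ n) _).trans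
      (add_le_add hmain' b3))).trans ?_
    have c1 : |θ| * (k * Cφ + 2 * Cψ) ≤ |a| * (Cφ + 2 * Cψ) * r⁻¹ := by
      calc |θ| * (k * Cφ + 2 * Cψ) ≤ |θ| * (r * Cφ + 2 * (r * Cψ)) := by
            gcongr
            exact le_mul_of_one_le_left hCψ0 hr1
        _ = (|θ| * r) * (Cφ + 2 * Cψ) := by ring
        _ = _ := by rw [hθr]; ring
    have c2 : (n : ℝ) * (C * (|θ| ^ 3 + ((N : ℝ) ^ 2)⁻¹ + 1 / (N : ℝ) ^ 2)) ≤
        2 * (C * (|a| ^ 3 + 2)) * r⁻¹ := by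
      have hn2 : (n : ℝ) ≤ 2 * r ^ 4 := by
        have : (n : ℝ) ≤ N + 1 := by exact_mod_cast (by omega : n ≤ N + 1)
        rw [← hr4]; linarith
      have e3 : |θ| ^ 3 = |a| ^ 3 / r ^ 6 := by rw [hθabs, div_pow, ← pow_mul]
      have e4 : (N : ℝ) ^ 2 = r ^ 8 := by rw [hr4]; ring
      rw [e3, e4]
      have hq : (r ^ 8)⁻¹ ≤ (r ^ 6)⁻¹ := by
        have : r ^ 6 ≤ r ^ 8 := pow_le_pow_right₀ hr1 (by norm_num)
        gcongr
      calc _ ≤ 2 * r ^ 4 * (C * (|a| ^ 3 / r ^ 6 + (r ^ 6)⁻¹ + (r ^ 6)⁻¹)) := by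
            rw [one_div]; gcongr
        _ = 2 * (C * (|a| ^ 3 + 2)) * (r ^ 2)⁻¹ := by field_simp; ring
        _ ≤ _ := by
            have : r ≤ r ^ 2 := le_self_pow₀ hr1 two_ne_zero
            gcongr
    have c3 : ((k + 1 : ℕ) : ℝ) * (|θ| * Cm) ≤ 2 * (|a| * Cm) * r⁻¹ := by
      have : ((k + 1 : ℕ) : ℝ) ≤ 2 * r := by push_cast; linarith
      calc _ ≤ 2 * r * (|θ| * Cm) := by gcongr
        _ = 2 * (|θ| * r) * Cm := by ring
        _ = _ := by rw [hθr]; ring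
    calc _ ≤ _ := add_le_add c1 (add_le_add c2 c3)
      _ = _ := by ring
  refine squeeze_zero_norm' hbound ?_
  have := (tendsto_inv_atTop_zero.comp hr).const_mul
    (|a| * (Cφ + 2 * Cψ) + 2 * (C * (|a| ^ 3 + 2)) + 2 * (|a| * Cm))
  rwa [mul_zero] at this

end StdMap

theorem theoremB (M₀ : ℕ) (K₀ K₁ : ℝ) (hK₀ : 0 < K₀) (hK₁ : 0 < K₁)
    (α : ℝ≥0) (hα : 0 < α) (hα1 : α ≤ 1) :
    ∃ L₀ : ℝ, 0 < L₀ ∧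
      ∀ (L : ℕ → ℝ) (f : ℕ → ℝ → ℝ),
        MonotoneOn L (Set.Ici 1) → L₀ ≤ L 1 →
        (∀ n, 1 ≤ n → StdMap.Admissible M₀ K₀ K₁ (L n) (f n)) →
        Tendsto (fun N : ℕ => (N : ℝ) ^ 8 * L N ^ (-((α : ℝ) / (3 * (α : ℝ) + 4)))) atTop (𝓝 0) →
        ∀ φ : StdMap.Torus2 → ℝ, (∃ C : ℝ≥0, HolderWith C α φ) → ∫ p, φ p = 0 →
          ∃ σ : ℝ, 0 ≤ σ ∧ σ ^ 2 = StdMap.asympVar φ ∧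
            (0 < σ →
              ∀ {Ω : Type*} [MeasurableSpace Ω] (P : Measure Ω) [IsProbabilityMeasure P]
                (X : Ω → StdMap.Torus2), HasLaw X volume P →
                TendstoInDistribution
                  (fun (N : ℕ) (ω : Ω) =>
                    1 / (σ * √(N : ℝ)) *
                      ∑ i ∈ Finset.range (N + 1), φ (StdMap.comp f i (X ω)))
                  atTop (fun t : ℝ => t) (fun _ => P) (gaussianReal 0 1)) ∧
            (σ = 0 ↔ ∃ ψ : UnitAddCircle → ℝ, Continuous ψ ∧ ∀ x y, φ (x, y) = ψ x - ψ y) := by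
  -- only the positivity of the coefficients is drawn from the lower bound on `L 1`: their size is
  -- supplied by the growth hypothesis
  refine ⟨1, one_pos, fun L f hL hL1 hf hlim φ ⟨K, hφ⟩ h0 => ?_⟩
  have hLpos : ∀ n, 1 ≤ n → 0 < L n := fun n hn =>
    one_pos.trans_le (hL1.trans (hL Set.self_mem_Ici hn hn))
  have hvar := StdMap.integral_martingalePart_sq hα hφ h0
  have hvar0 : 0 ≤ StdMap.asympVar φ := hvar ▸ integral_nonneg fun p => sq_nonneg _
  have hmc := (StdMap.holderWith_martingalePart hα hφ).continuous hα
  have hφc := hφ.continuous hα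
  have hmean : ∫ p, StdMap.martingalePart φ p = 0 := by
    rw [StdMap.integral_torus hmc]
    simp only [StdMap.integral_martingalePart_fst hα hφ h0, integral_zero]
  refine ⟨√(StdMap.asympVar φ), Real.sqrt_nonneg _, Real.sq_sqrt hvar0, ?_, ?_⟩
  · intro hσ Ω _ P _ X hX
    set σ := √(StdMap.asympVar φ) with hσ_def
    have hfc : ∀ n, Measurable (StdMap.comp f n) := fun n =>
      (StdMap.measurePreserving_comp
        (fun n => (hf (n + 1) (by omega)).contDiff.continuous.measurable) n).measurable
    have hS : ∀ N : ℕ, Measurable fun p => 1 / (σ * √(N : ℝ)) *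
        ∑ i ∈ Finset.range (N + 1), φ (StdMap.comp f i p) := fun N =>
      (Finset.measurable_fun_sum _ fun i _ => hφc.measurable.comp (hfc i)).const_mul _
    refine
      { forall_aemeasurable := fun N => (hS N).comp_aemeasurable hX.aemeasurable
        tendsto := ProbabilityMeasure.tendsto_iff_tendsto_charFun.2 fun t => ?_ }
    have h1 := StdMap.exists_norm_charFun_birkhoff_sub_le M₀ hK₀ hK₁ hα hα1 hφ h0 hLpos hf hlim
      (t / σ)
    have h2 := StdMap.tendsto_integral_cexp_pow hmc hσ hmean
      (hvar.trans (Real.sq_sqrt hvar0).symm) t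
    have h3 := h1.add h2
    simp only [sub_add_cancel, zero_add] at h3
    have hlimit : charFun ((gaussianReal 0 1).map fun t : ℝ => t) t =
        Complex.exp (-t ^ 2 / 2) := by
      rw [Measure.map_id', charFun_gaussianReal]
      congr 1
      push_cast
      ring
    simp only [ProbabilityMeasure.coe_mk]
    rw [hlimit]
    refine h3.congr fun N => ?_
    have hSX : AEMeasurable (fun ω => 1 / (σ * √(N : ℝ)) *
        ∑ i ∈ Finset.range (N + 1), φ (StdMap.comp f i (X ω))) P :=
      (hS N).comp_aemeasurable hX.aemeasurable
    rw [charFun_apply_real, integral_map hSX (by fun_prop), ← hX.map_eq,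
      integral_map hX.aemeasurable ?_]
    · refine integral_congr_ae (Eventually.of_forall fun ω => ?_)
      simp only
      rw [← Complex.ofReal_mul]
      congr 3
      ring
    · refine Measurable.aestronglyMeasurable ?_
      have h4 : Measurable fun p =>
          t / σ / √(N : ℝ) * ∑ i ∈ Finset.range (N + 1), φ (StdMap.comp f i p) :=
        (Finset.measurable_fun_sum _ fun i _ => hφc.measurable.comp (hfc i)).const_mul _
      fun_prop
  · rw [Real.sqrt_eq_zero hvar0]
    exact StdMap.asympVar_eq_zero_iff hα hφ h0
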